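/- An infinite Young tableau is a matrix $t=(t_{i,j})_{i,j\ge 1}$ of positive integers in which every positive integer appears exactly once and whose rows and columns are increasing. Let $\Omega$ be the set of infinite Young tableaux and $\mathcal F$ the smallest $\sigma$-algebra on $\Omega$ making all maps $t\mapsto t_{i,j}$ measurable. For a Young diagram $\lambda$ let $|\lambda|$ be its number of boxes and $f^\lambda$ the number of standard Young tableaux of shape $\lambda$, and write $\lambda\nearrow\nu$ if $\nu$ arises from $\lambda$ by adding one box. The Plancherel growth process is the Markov chain $\emptyset=\Lambda_0\nearrow\Lambda_1\nearrow\cdots$ on Young diagrams with transition probability $\frac{f^\nu}{(|\lambda|+1)f^\lambda}$ from $\lambda$ to each $\nu$ with $\lambda\nearrow\nu$. A tableau $t\in\Omega$ is identified with the path $\Lambda_n(t)=\{(i,j): t_{i,j}\le n\}$; this identifies $\Omega$ with the set of paths in the Young graph that start at $\emptyset$ and eventually contain every box. The Plancherel measure $\mathsf P$ on $(\Omega,\mathcal F)$ is the law of the Plancherel growth process under this identification. The jeu de taquin path of $t\in\Omega$ is $\mathbf p_1=(1,1)$ and, if $\mathbf p_k=(i,j)$, $\mathbf p_{k+1}$ is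 the one of the boxes $(i+1,j)$, $(i,j+1)$ with the smaller entry in $t$. The jeu de taquin map $J:\Omega\to\Omega$ is defined by $J(t)_{\mathbf p_k}=t_{\mathbf p_{k+1}}-1$ for all $k$, and $J(t)_{i,j}=t_{i,j}-1$ if $(i,j)$ is not on the path. For a sequence $x=(x_1,x_2,\dots)$ of distinct numbers in $[0,1]$ let $\lambda_n$ be the shape obtained by Robinson--Schensted row insertion of $x_1,\dots,x_n$. If every box eventually belongs to some $\lambda_n$, then $\mathrm{RSK}(x)\in\Omega$ is defined as the recording tableau of $\emptyset=\lambda_0\nearrow\lambda_1\nearrow\cdots$, i.e. $\Lambda_n(\mathrm{RSK}(x))=\lambda_n$ for all $n$. Let $S(x_1,x_2,\dots)=(x_2,x_3,\dots)$ be the shift on $[0,1]^{\mathbb N}$ with the product $\mathrm{Leb}^{\otimes\mathbb N}$ of Lebesgue measures. **Theorem (Measure preservation and ergodicity).** $\mathsf P$ is a probability measure, and the dynamical system $(\Omega,\mathcal F,\mathsf P,J)$ is measure-preserving and ergodic. Moreover it is a factor, via $\mathrm{RSK}$, of the i.i.d. shift $([0,1]^{\mathbb N},\mathrm{Leb}^{\otimes\mathbb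 N},S)$: $\mathrm{RSK}(x)$ is defined for $\mathrm{Leb}^{\otimes\mathbb N}$-almost every $x$, the map $\mathrm{RSK}$ is measurable and pushes $\mathrm{Leb}^{\otimes\mathbb N}$ forward to $\mathsf P$, and whenever $\mathrm{RSK}(x)$ is defined, so is $\mathrm{RSK}(Sx)$, and $J(\mathrm{RSK}(x))=\mathrm{RSK}(Sx)$. -/

import Mathlib

open MeasureTheory ProbabilityTheory
open scoped ENNReal

namespace JeuDeTaquin

/-- The edge relation `μ ↗ ν` of the Young graph: `ν` is `μ` with one box added. -/
def Adds (μ ν : YoungDiagram) : Prop := μ ≤ ν ∧ ν.card = μ.card + 1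

/-- `T` is a standard Young tableau of shape `μ`: the boxes of `μ` are filled bijectively with
`1, …, |μ|`, increasingly along rows and columns (and `T` is `0` off `μ`, so that `T` is
determined by the filling). -/
structure IsStandardTableau (μ : YoungDiagram) (T : ℕ × ℕ → ℕ) : Prop where
  zero_off : ∀ c, c ∉ μ → T c = 0
  bijOn : Set.BijOn T (μ : Set (ℕ × ℕ)) (Set.Icc 1 μ.card)
  row_lt : ∀ i j, (i, j + 1) ∈ μ → T (i, j) < T (i, j + 1)
  col_lt : ∀ i j, (i + 1, j) ∈ μ → T (i, j) < T (i + 1, j)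

/-- `f^μ`, the number of standard Young tableaux of shape `μ`. -/
noncomputable def numSYT (μ : YoungDiagram) : ℕ := Nat.card {T : ℕ × ℕ → ℕ // IsStandardTableau μ T}

theorem finite_standardTableau (μ : YoungDiagram) :
    Finite {T : ℕ × ℕ → ℕ // IsStandardTableau μ T} := by
  refine Finite.of_injective
    (β := μ.cells → Fin (μ.card + 1))
    (fun T c => ⟨T.1 c.1, Nat.lt_succ_of_le (T.2.bijOn.mapsTo c.2).2⟩) ?_
  intro S T h
  apply Subtype.ext
  funext c
  by_cases hc : c ∈ μ
  · have := congrFun h ⟨c, hc⟩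
    simpa using this
  · rw [S.2.zero_off c hc, T.2.zero_off c hc]

theorem numSYT_bot : numSYT ⊥ = 1 := by
  rw [numSYT, Nat.card_eq_one_iff_unique]
  refine ⟨⟨fun S T => Subtype.ext (funext fun c => ?_)⟩, ⟨⟨fun _ => 0, ?_⟩⟩⟩
  · rw [S.2.zero_off c (YoungDiagram.notMem_bot c), T.2.zero_off c (YoungDiagram.notMem_bot c)]
  · constructor <;> simp [YoungDiagram.card, Set.BijOn, Set.MapsTo, Set.SurjOn, Set.InjOn]

/-- Removing the box with the largest entry. -/
def delMax (ν : YoungDiagram) (T : ℕ × ℕ → ℕ) (hT : IsStandardTableau ν T) : YoungDiagram where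
  cells := ν.cells.filter (fun c => T c ≠ ν.card)
  isLowerSet := by
    rintro ⟨i, j⟩ ⟨i', j'⟩ hle hc
    obtain ⟨hi, hj⟩ := Prod.mk_le_mk.1 hle
    simp only [Finset.coe_filter, Set.mem_ofPred_eq, YoungDiagram.mem_cells] at hc ⊢
    refine ⟨ν.up_left_mem hi hj hc.1, fun hmax => ?_⟩
    have key : ∀ d, d ∈ ν → T d ≤ ν.card := fun d hd => (hT.bijOn.mapsTo hd).2
    rcases Nat.lt_or_ge i' i with h | h
    · have hm : (i' + 1, j') ∈ ν := ν.up_left_mem h hj hc.1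
      have := hT.col_lt _ _ hm
      have := key _ hm
      omega
    · rcases Nat.lt_or_ge j' j with h' | h'
      · have hm : (i', j' + 1) ∈ ν := ν.up_left_mem hi h' hc.1
        have := hT.row_lt _ _ hm
        have := key _ hm
        omega
      · obtain rfl : i' = i := le_antisymm hi h
        obtain rfl : j' = j := le_antisymm hj h'
        exact hc.2 hmax

theorem mem_delMax {ν : YoungDiagram} {T : ℕ × ℕ → ℕ} (hT : IsStandardTableau ν T) {c : ℕ × ℕ} :
    c ∈ delMax ν T hT ↔ c ∈ ν ∧ T c ≠ ν.card := by
  rw [← YoungDiagram.mem_cells]; simp [delMax]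

theorem adds_delMax {ν : YoungDiagram} {T : ℕ × ℕ → ℕ} (hT : IsStandardTableau ν T)
    (hν : 0 < ν.card) : Adds (delMax ν T hT) ν := by
  refine ⟨fun c hc => ((mem_delMax hT).1 hc).1, ?_⟩
  obtain ⟨m, hm, hTm⟩ := hT.bijOn.surjOn (Set.mem_Icc.2 ⟨hν, le_rfl⟩)
  have : (delMax ν T hT).cells = ν.cells.erase m := by
    ext c
    simp only [YoungDiagram.mem_cells, mem_delMax, Finset.mem_erase]
    constructor
    · rintro ⟨h1, h2⟩
      exact ⟨fun h => h2 (h ▸ hTm), h1⟩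
    · rintro ⟨h1, h2⟩
      exact ⟨h2, fun h => h1 (hT.bijOn.injOn h2 hm (h.trans hTm.symm))⟩
  have hm' : m ∈ ν.cells := hm
  rw [YoungDiagram.card, YoungDiagram.card, this, Finset.card_erase_add_one hm']

theorem isStandardTableau_delMax {ν : YoungDiagram} {T : ℕ × ℕ → ℕ} (hT : IsStandardTableau ν T)
    (hν : 0 < ν.card) :
    IsStandardTableau (delMax ν T hT) (fun c => if T c = ν.card then 0 else T c) := by
  have hcard := (adds_delMax hT hν).2
  refine ⟨fun c hc => ?_, ⟨fun c hc => ?_, fun c hc d hd h => ?_, fun k hk => ?_⟩,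
    fun i j h => ?_, fun i j h => ?_⟩
  · rw [mem_delMax] at hc
    by_cases h : T c = ν.card
    · simp [h]
    · have : c ∉ ν := fun h' => hc ⟨h', h⟩
      simp [hT.zero_off c this]
  · obtain ⟨h1, h2⟩ := (mem_delMax hT).1 hc
    have := hT.bijOn.mapsTo h1
    simp only [h2, if_false, Set.mem_Icc] at this ⊢
    omega
  · obtain ⟨h1, h2⟩ := (mem_delMax hT).1 hc
    obtain ⟨h3, h4⟩ := (mem_delMax hT).1 hd
    simp only [h2, h4, if_false] at h
    exact hT.bijOn.injOn h1 h3 h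
  · obtain ⟨c, hc, hk'⟩ := hT.bijOn.surjOn (a := k) (Set.mem_Icc.2 ⟨hk.1, by have := hk.2; omega⟩)
    have hne : T c ≠ ν.card := by have := hk.2; omega
    exact ⟨c, (mem_delMax hT).2 ⟨hc, hne⟩, (if_neg hne).trans hk'⟩
  · have hm := (mem_delMax hT).1 h
    have h1 := hT.row_lt i j hm.1
    have h2 := (hT.bijOn.mapsTo hm.1).2
    have h3 : T (i, j) ≠ ν.card := by omega
    simpa [hm.2, h3] using h1
  · have hm := (mem_delMax hT).1 h
    have h1 := hT.col_lt i j hm.1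
    have h2 := (hT.bijOn.mapsTo hm.1).2
    have h3 : T (i, j) ≠ ν.card := by omega
    simpa [hm.2, h3] using h1

theorem isStandardTableau_extend {μ ν : YoungDiagram} (h : Adds μ ν) {T : ℕ × ℕ → ℕ}
    (hT : IsStandardTableau μ T) :
    IsStandardTableau ν (fun c => if c ∈ ν ∧ c ∉ μ then ν.card else T c) := by
  have hcard := h.2
  have hsub : μ.cells ⊆ ν.cells := h.1
  have hone : (ν.cells \ μ.cells).card = 1 := by
    rw [Finset.card_sdiff_of_subset hsub]
    have h1 : ν.cells.card = μ.cells.card + 1 := hcard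
    omega
  obtain ⟨m, hm⟩ := Finset.card_eq_one.1 hone
  have hmem : ∀ c, (c ∈ ν ∧ c ∉ μ) ↔ c = m := fun c => by
    have := Finset.ext_iff.1 hm c
    simpa using this
  have hmm := (hmem m).2 rfl
  have hin : ∀ c, c ∈ ν → c ≠ m → c ∈ μ := fun c hc hne => by
    by_contra hcon
    exact hne ((hmem c).1 ⟨hc, hcon⟩)
  have hμm : ∀ c, c ∈ μ → c ≠ m := fun c hc he => hmm.2 (he ▸ hc)
  simp only [hmem]
  refine ⟨fun c hc => ?_, ⟨fun c hc => ?_, fun c hc d hd he => ?_, fun k hk => ?_⟩,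
    fun i j h' => ?_, fun i j h' => ?_⟩
  · have h1 : c ≠ m := fun he => hc (he ▸ hmm.1)
    simp [h1, hT.zero_off c (fun h2 => hc (hsub h2))]
  · by_cases h1 : c = m
    · simp only [h1, if_true, Set.mem_Icc]; omega
    · have := hT.bijOn.mapsTo (hin c hc h1)
      simp only [h1, if_false, Set.mem_Icc] at this ⊢
      omega
  · by_cases h1 : c = m <;> by_cases h2 : d = m
    · rw [h1, h2]
    · have := (hT.bijOn.mapsTo (hin d hd h2)).2
      simp only [h1, h2, if_true, if_false] at he
      omega
    · have := (hT.bijOn.mapsTo (hin c hc h1)).2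
      simp only [h1, h2, if_true, if_false] at he
      omega
    · simp only [h1, h2, if_false] at he
      exact hT.bijOn.injOn (hin c hc h1) (hin d hd h2) he
  · by_cases h1 : k = ν.card
    · exact ⟨m, hmm.1, by simp [h1]⟩
    · obtain ⟨c, hc, hck⟩ := hT.bijOn.surjOn (a := k)
        (Set.mem_Icc.2 ⟨hk.1, by have := hk.2; omega⟩)
      exact ⟨c, hsub hc, by simp [hμm c hc, hck]⟩
  · have hl : (i, j) ∈ ν := ν.up_left_mem le_rfl (Nat.le_succ j) h'
    by_cases h1 : (i, j + 1) = m
    · have h2 : (i, j) ≠ m := by rw [← h1]; simp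
      have := (hT.bijOn.mapsTo (hin _ hl h2)).2
      simp only [h1, h2, if_true, if_false]
      omega
    · have h3 := hin _ h' h1
      have h2 := hμm _ (μ.up_left_mem le_rfl (Nat.le_succ j) h3)
      simpa [h1, h2] using hT.row_lt i j h3
  · have hl : (i, j) ∈ ν := ν.up_left_mem (Nat.le_succ i) le_rfl h'
    by_cases h1 : (i + 1, j) = m
    · have h2 : (i, j) ≠ m := by rw [← h1]; simp
      have := (hT.bijOn.mapsTo (hin _ hl h2)).2
      simp only [h1, h2, if_true, if_false]
      omega
    · have h3 := hin _ h' h1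
      have h2 := hμm _ (μ.up_left_mem (Nat.le_succ i) le_rfl h3)
      simpa [h1, h2] using hT.col_lt i j h3

theorem eq_delMax_extend {μ ν : YoungDiagram} (h : Adds μ ν) {T : ℕ × ℕ → ℕ}
    (hT : IsStandardTableau μ T) :
    delMax ν _ (isStandardTableau_extend h hT) = μ := by
  ext c
  simp only [YoungDiagram.mem_cells, mem_delMax]
  have hcard := h.2
  constructor
  · rintro ⟨h1, h2⟩
    by_contra h3
    simp [h1, h3] at h2
  · intro hc
    refine ⟨h.1 hc, ?_⟩
    have := (hT.bijOn.mapsTo hc).2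
    simp only [hc, not_true_eq_false, and_false, if_false]
    omega

/-- There are finitely many Young diagrams with `n` boxes. -/
theorem finite_card_eq (n : ℕ) : {μ : YoungDiagram | μ.card = n}.Finite := by
  refine Set.Finite.of_finite_image (f := YoungDiagram.cells)
    (((Finset.range n ×ˢ Finset.range n).powerset).finite_toSet.subset ?_)
    (fun μ _ ν _ h => YoungDiagram.ext h)
  rintro _ ⟨μ, hμ, rfl⟩
  simp only [Finset.coe_powerset, Set.mem_preimage, Set.mem_powerset_iff, Finset.coe_subset]
  rintro ⟨i, j⟩ hc
  have hc' : (i, j) ∈ μ := hc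
  have h1 : (Finset.range (i + 1) ×ˢ {0}) ⊆ μ.cells := by
    rintro ⟨a, b⟩ hab
    simp only [Finset.mem_product, Finset.mem_range, Finset.mem_singleton] at hab
    exact μ.up_left_mem (by omega) (by omega) hc'
  have h2 : ({0} ×ˢ Finset.range (j + 1)) ⊆ μ.cells := by
    rintro ⟨a, b⟩ hab
    simp only [Finset.mem_product, Finset.mem_range, Finset.mem_singleton] at hab
    exact μ.up_left_mem (by omega) (by omega) hc'
  have h1' := Finset.card_le_card h1
  have h2' := Finset.card_le_card h2
  have hμ' : μ.cells.card = n := hμ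
  simp only [Finset.card_product, Finset.card_range, Finset.card_singleton, mul_one, one_mul]
    at h1' h2'
  simp only [Finset.mem_product, Finset.mem_range]
  omega

/-- The finite set of Young diagrams with `n` boxes. -/
noncomputable def diagrams (n : ℕ) : Finset YoungDiagram := (finite_card_eq n).toFinset

theorem mem_diagrams {n : ℕ} {μ : YoungDiagram} : μ ∈ diagrams n ↔ μ.card = n := by
  simp [diagrams]

open Classical in
/-- The branching rule `f^ν = ∑_{μ ↗ ν} f^μ`. -/
theorem numSYT_branching (n : ℕ) {ν : YoungDiagram} (hν : ν.card = n + 1) :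
    numSYT ν = ∑ μ ∈ (diagrams n).filter (· ≤ ν), numSYT μ := by
  have hν0 : 0 < ν.card := by omega
  have hmem : ∀ μ, μ ∈ (diagrams n).filter (· ≤ ν) ↔ Adds μ ν := fun μ => by
    rw [Finset.mem_filter, mem_diagrams, Adds, hν]
    constructor
    · rintro ⟨h1, h2⟩; exact ⟨h2, by omega⟩
    · rintro ⟨h1, h2⟩; exact ⟨by omega, h1⟩
  rw [← Finset.sum_coe_sort]
  have := finite_standardTableau
  unfold numSYT
  rw [← Nat.card_sigma]
  refine Nat.card_congr
    { toFun := fun T => ⟨⟨delMax ν T.1 T.2, (hmem _).2 (adds_delMax T.2 hν0)⟩,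
        ⟨_, isStandardTableau_delMax T.2 hν0⟩⟩
      invFun := fun p => ⟨_, isStandardTableau_extend ((hmem _).1 p.1.2) p.2.2⟩
      left_inv := ?_
      right_inv := ?_ }
  · rintro ⟨T, hT⟩
    apply Subtype.ext
    funext c
    simp only [mem_delMax]
    by_cases h1 : T c = ν.card
    · have : c ∈ ν := by
        by_contra h2
        rw [hT.zero_off c h2] at h1
        omega
      simp [h1, this]
    · simp [h1]
  · rintro ⟨⟨μ, hμ⟩, ⟨T, hT⟩⟩
    have hadd := (hmem _).1 hμ
    have hcard := hadd.2
    have e := eq_delMax_extend hadd hT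
    refine Sigma.subtype_ext (Subtype.ext e) ?_
    funext c
    simp only
    by_cases h1 : c ∈ ν ∧ c ∉ μ
    · simp only [h1, not_false_eq_true, and_self, if_true]
      exact (hT.zero_off c h1.2).symm
    · simp only [h1, if_false]
      by_cases h2 : c ∈ μ
      · have := (hT.bijOn.mapsTo h2).2
        have hc2 : ν.card = μ.card + 1 := hcard
        have hc3 : T c ≤ μ.card := this
        rw [if_neg (by omega)]
      · simp [hT.zero_off c h2]


theorem exists_eq_insert {μ ν : YoungDiagram} (h : Adds μ ν) :
    ∃ m, m ∉ μ ∧ ∀ c, c ∈ ν ↔ c = m ∨ c ∈ μ := by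
  have hsub : μ.cells ⊆ ν.cells := h.1
  have hone : (ν.cells \ μ.cells).card = 1 := by
    rw [Finset.card_sdiff_of_subset hsub]
    have h1 : ν.cells.card = μ.cells.card + 1 := h.2
    omega
  obtain ⟨m, hm⟩ := Finset.card_eq_one.1 hone
  have hmem : ∀ c, (c ∈ ν ∧ c ∉ μ) ↔ c = m := fun c => by
    have := Finset.ext_iff.1 hm c
    simpa using this
  refine ⟨m, ((hmem m).2 rfl).2, fun c => ⟨fun hc => ?_, ?_⟩⟩
  · by_cases h1 : c ∈ μ
    · exact Or.inr h1
    · exact Or.inl ((hmem c).1 ⟨hc, h1⟩)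
  · rintro (rfl | hc)
    · exact ((hmem _).2 rfl).1
    · exact h.1 hc

/-- The rows of `μ` from which a box can be removed. -/
def cornerRows (μ : YoungDiagram) : Finset ℕ :=
  (μ.cells.image Prod.fst).filter (fun i => μ.rowLen (i + 1) < μ.rowLen i)

theorem mem_cornerRows {μ : YoungDiagram} {i : ℕ} :
    i ∈ cornerRows μ ↔ μ.rowLen (i + 1) < μ.rowLen i := by
  simp only [cornerRows, Finset.mem_filter, Finset.mem_image, and_iff_right_iff_imp]
  intro h
  exact ⟨(i, 0), YoungDiagram.mem_iff_lt_rowLen.2 (by omega), rfl⟩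

/-- Adding a box at the end of row `i`. -/
def addBox (μ : YoungDiagram) (i : ℕ) (hi : i = 0 ∨ ∃ k ∈ cornerRows μ, k + 1 = i) :
    YoungDiagram where
  cells := insert (i, μ.rowLen i) μ.cells
  isLowerSet := by
    rintro ⟨a, b⟩ ⟨a', b'⟩ hle hc
    obtain ⟨ha, hb⟩ := Prod.mk_le_mk.1 hle
    simp only [Finset.coe_insert, Set.mem_insert_iff, Finset.mem_coe, YoungDiagram.mem_cells,
      Prod.mk.injEq] at hc ⊢
    rcases hc with ⟨rfl, rfl⟩ | hc
    · by_cases hb' : b' = μ.rowLen a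
      · by_cases ha' : a' = a
        · exact Or.inl ⟨ha', hb'⟩
        · right
          rcases hi with h0 | ⟨k, hk, rfl⟩
          · omega
          · rw [mem_cornerRows] at hk
            have := μ.rowLen_anti a' k (by omega)
            exact YoungDiagram.mem_iff_lt_rowLen.2 (by omega)
      · right
        have := μ.rowLen_anti a' a ha
        exact YoungDiagram.mem_iff_lt_rowLen.2 (by omega)
    · exact Or.inr (μ.up_left_mem ha hb hc)

theorem mem_addBox {μ : YoungDiagram} {i : ℕ} (hi : i = 0 ∨ ∃ k ∈ cornerRows μ, k + 1 = i)
    {c : ℕ × ℕ} : c ∈ addBox μ i hi ↔ c = (i, μ.rowLen i) ∨ c ∈ μ := by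
  rw [← YoungDiagram.mem_cells]; simp [addBox]

theorem end_notMem (μ : YoungDiagram) (i : ℕ) : (i, μ.rowLen i) ∉ μ := by
  rw [YoungDiagram.mem_iff_lt_rowLen]; omega

/-- Removing the box at the end of row `i`. -/
def delBox (μ : YoungDiagram) (i : ℕ) (hi : i ∈ cornerRows μ) : YoungDiagram where
  cells := μ.cells.erase (i, μ.rowLen i - 1)
  isLowerSet := by
    rw [mem_cornerRows] at hi
    rintro ⟨a, b⟩ ⟨a', b'⟩ hle hc
    obtain ⟨ha, hb⟩ := Prod.mk_le_mk.1 hle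
    simp only [Finset.coe_erase, Set.mem_sdiff, Set.mem_singleton_iff, Finset.mem_coe,
      YoungDiagram.mem_cells, Prod.mk.injEq] at hc ⊢
    refine ⟨μ.up_left_mem ha hb hc.1, ?_⟩
    rintro ⟨rfl, rfl⟩
    have h1 := YoungDiagram.mem_iff_lt_rowLen.1 hc.1
    by_cases h2 : a = a'
    · subst h2
      apply hc.2
      omega
    · have := μ.rowLen_anti (a' + 1) a (by omega)
      omega

theorem mem_delBox {μ : YoungDiagram} {i : ℕ} (hi : i ∈ cornerRows μ) {c : ℕ × ℕ} :
    c ∈ delBox μ i hi ↔ c ≠ (i, μ.rowLen i - 1) ∧ c ∈ μ := by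
  rw [← YoungDiagram.mem_cells]; simp [delBox]

theorem adds_addBox {μ : YoungDiagram} {i : ℕ} (hi : i = 0 ∨ ∃ k ∈ cornerRows μ, k + 1 = i) :
    Adds μ (addBox μ i hi) := by
  refine ⟨fun c hc => (mem_addBox hi).2 (Or.inr hc), ?_⟩
  rw [YoungDiagram.card, YoungDiagram.card, addBox, Finset.card_insert_of_notMem]
  exact end_notMem μ i

theorem adds_delBox {μ : YoungDiagram} {i : ℕ} (hi : i ∈ cornerRows μ) :
    Adds (delBox μ i hi) μ := by
  refine ⟨fun c hc => ((mem_delBox hi).1 hc).2, ?_⟩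
  have : (i, μ.rowLen i - 1) ∈ μ.cells := by
    rw [mem_cornerRows] at hi
    rw [YoungDiagram.mem_cells, YoungDiagram.mem_iff_lt_rowLen]
    omega
  rw [YoungDiagram.card, YoungDiagram.card, delBox, Finset.card_erase_add_one this]

open Classical in
theorem card_up {n : ℕ} {μ : YoungDiagram} (hμ : μ.card = n) :
    ((diagrams (n + 1)).filter (μ ≤ ·)).card = (cornerRows μ).card + 1 := by
  have hset : ((cornerRows μ).card + 1) = (insert 0 ((cornerRows μ).image (· + 1))).card := by
    rw [Finset.card_insert_of_notMem (by simp),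
      Finset.card_image_of_injective _ (add_left_injective 1)]
  have hS : ∀ i, i ∈ insert 0 ((cornerRows μ).image (· + 1)) →
      (i = 0 ∨ ∃ k ∈ cornerRows μ, k + 1 = i) := fun i hi => by simpa using hi
  rw [hset]
  symm
  refine Finset.card_bij (fun i hi => addBox μ i (hS i hi)) (fun i hi => ?_)
    (fun i hi k hk h => ?_) (fun ν hν => ?_)
  · have := adds_addBox (hS i hi)
    rw [Finset.mem_filter, mem_diagrams]
    exact ⟨by rw [this.2, hμ], this.1⟩
  · have h1 : (i, μ.rowLen i) ∈ addBox μ k (hS k hk) := by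
      rw [← h, mem_addBox]; exact Or.inl rfl
    rw [mem_addBox] at h1
    rcases h1 with h1 | h1
    · exact (Prod.mk.inj h1).1
    · exact absurd h1 (end_notMem μ i)
  · rw [Finset.mem_filter, mem_diagrams] at hν
    obtain ⟨⟨i, j⟩, hm, hc⟩ := exists_eq_insert (μ := μ) (ν := ν) ⟨hν.2, by omega⟩
    have hij : (i, j) ∈ ν := (hc _).2 (Or.inl rfl)
    have hj : j = μ.rowLen i := by
      rw [YoungDiagram.mem_iff_lt_rowLen] at hm
      by_contra hne
      have h1 : (i, μ.rowLen i) ∈ ν := ν.up_left_mem le_rfl (by omega) hij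
      rcases (hc _).1 h1 with h2 | h2
      · exact hne (Prod.mk.inj h2).2.symm
      · exact end_notMem μ i h2
    have hi : i ∈ insert 0 ((cornerRows μ).image (· + 1)) := by
      rcases i with _ | k
      · simp
      · rw [Finset.mem_insert, Finset.mem_image]
        refine Or.inr ⟨k, ?_, rfl⟩
        have h1 : (k, j) ∈ ν := ν.up_left_mem (Nat.le_succ k) le_rfl hij
        rcases (hc _).1 h1 with h2 | h2
        · have := (Prod.mk.inj h2).1
          omega
        · rw [YoungDiagram.mem_iff_lt_rowLen] at h2
          rw [mem_cornerRows]
          omega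
    refine ⟨i, hi, ?_⟩
    ext c
    rw [YoungDiagram.mem_cells, YoungDiagram.mem_cells, mem_addBox, hc, hj]

open Classical in
theorem card_down {n : ℕ} {μ : YoungDiagram} (hμ : μ.card = n + 1) :
    ((diagrams n).filter (· ≤ μ)).card = (cornerRows μ).card := by
  symm
  refine Finset.card_bij (fun i hi => delBox μ i hi) (fun i hi => ?_)
    (fun i hi k hk h => ?_) (fun κ hκ => ?_)
  · have := adds_delBox hi
    have h2 := this.2
    rw [Finset.mem_filter, mem_diagrams]
    exact ⟨by omega, this.1⟩
  · have h0 : (i, μ.rowLen i - 1) ∈ μ := by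
      rw [mem_cornerRows] at hi
      rw [YoungDiagram.mem_iff_lt_rowLen]
      omega
    have h1 : (i, μ.rowLen i - 1) ∉ delBox μ k hk := by
      rw [← h, mem_delBox]; simp
    rw [mem_delBox] at h1
    by_contra hne
    exact h1 ⟨fun h2 => hne (Prod.mk.inj h2).1, h0⟩
  · rw [Finset.mem_filter, mem_diagrams] at hκ
    obtain ⟨⟨i, j⟩, hm, hc⟩ := exists_eq_insert (μ := κ) (ν := μ) ⟨hκ.2, by omega⟩
    have hij : (i, j) ∈ μ := (hc _).2 (Or.inl rfl)
    have hlt := YoungDiagram.mem_iff_lt_rowLen.1 hij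
    have hj : j = μ.rowLen i - 1 := by
      by_contra hne
      have h1 : (i, j + 1) ∈ μ := by
        rw [YoungDiagram.mem_iff_lt_rowLen]
        omega
      rcases (hc _).1 h1 with h2 | h2
      · have := (Prod.mk.inj h2).2
        omega
      · exact hm (κ.up_left_mem le_rfl (Nat.le_succ j) h2)
    have hi : i ∈ cornerRows μ := by
      rw [mem_cornerRows]
      by_contra hne
      have h1 : (i + 1, j) ∈ μ := by
        rw [YoungDiagram.mem_iff_lt_rowLen]
        omega
      rcases (hc _).1 h1 with h2 | h2
      · have := (Prod.mk.inj h2).1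
        omega
      · exact hm (κ.up_left_mem (Nat.le_succ i) le_rfl h2)
    refine ⟨i, hi, ?_⟩
    ext c
    rw [YoungDiagram.mem_cells, YoungDiagram.mem_cells, mem_delBox, ← hj, hc]
    constructor
    · rintro ⟨h1, h2 | h2⟩
      · exact absurd h2 h1
      · exact h2
    · intro h1
      exact ⟨fun h2 => hm (h2 ▸ h1), Or.inr h1⟩

theorem eq_bot_of_card {μ : YoungDiagram} (h : μ.card = 0) : μ = ⊥ := by
  ext c
  have : μ.cells = ∅ := Finset.card_eq_zero.1 h
  simp [this]

theorem eq_of_le_of_card {μ ν : YoungDiagram} (h : μ ≤ ν) (hc : ν.card ≤ μ.card) : μ = ν :=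
  YoungDiagram.ext (Finset.eq_of_subset_of_card_le h hc)

theorem card_sup_add_card_inf (μ ν : YoungDiagram) :
    (μ ⊔ ν).card + (μ ⊓ ν).card = μ.card + ν.card := by
  simp only [YoungDiagram.card, YoungDiagram.cells_sup, YoungDiagram.cells_inf]
  exact Finset.card_union_add_card_inter _ _

theorem card_lt_card_of_lt {μ ν : YoungDiagram} (h : μ < ν) : μ.card < ν.card :=
  Finset.card_lt_card (YoungDiagram.cells_ssubset_iff.2 h)

open Classical in
theorem card_common_up_eq_down {n : ℕ} {μ ν : YoungDiagram} (hμ : μ.card = n + 1)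
    (hν : ν.card = n + 1) (hne : ν ≠ μ) :
    ((diagrams (n + 2)).filter (fun κ => μ ≤ κ ∧ ν ≤ κ)).card =
      ((diagrams n).filter (fun κ => κ ≤ μ ∧ κ ≤ ν)).card := by
  have hmod := card_sup_add_card_inf μ ν
  have hlt : μ.card < (μ ⊔ ν).card := by
    refine card_lt_card_of_lt (lt_of_le_of_ne le_sup_left fun h => hne ?_)
    exact eq_of_le_of_card (h ▸ le_sup_right) (by omega)
  by_cases hs : (μ ⊔ ν).card = n + 2
  · have h1 : (diagrams (n + 2)).filter (fun κ => μ ≤ κ ∧ ν ≤ κ) = {μ ⊔ ν} := by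
      ext κ
      rw [Finset.mem_filter, mem_diagrams, Finset.mem_singleton]
      constructor
      · rintro ⟨h1, h2, h3⟩
        exact (eq_of_le_of_card (sup_le h2 h3) (by omega)).symm
      · rintro rfl
        exact ⟨hs, le_sup_left, le_sup_right⟩
    have h2 : (diagrams n).filter (fun κ => κ ≤ μ ∧ κ ≤ ν) = {μ ⊓ ν} := by
      ext κ
      rw [Finset.mem_filter, mem_diagrams, Finset.mem_singleton]
      constructor
      · rintro ⟨h1, h2, h3⟩
        exact eq_of_le_of_card (le_inf h2 h3) (by omega)
      · rintro rfl
        exact ⟨by omega, inf_le_left, inf_le_right⟩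
    rw [h1, h2, Finset.card_singleton, Finset.card_singleton]
  · have h1 : (diagrams (n + 2)).filter (fun κ => μ ≤ κ ∧ ν ≤ κ) = ∅ := by
      refine Finset.filter_eq_empty_iff.2 fun κ hκ h => ?_
      rw [mem_diagrams] at hκ
      have : (μ ⊔ ν).card ≤ κ.card := Finset.card_le_card (sup_le h.1 h.2)
      omega
    have h2 : (diagrams n).filter (fun κ => κ ≤ μ ∧ κ ≤ ν) = ∅ := by
      refine Finset.filter_eq_empty_iff.2 fun κ hκ h => ?_
      rw [mem_diagrams] at hκ
      have : κ.card ≤ (μ ⊓ ν).card := Finset.card_le_card (le_inf h.1 h.2)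
      omega
    rw [h1, h2]

open Classical in
/-- The relation `(n + 1) f^μ = ∑_{μ ↗ ν} f^ν`. -/
theorem sum_numSYT_up (n : ℕ) : ∀ {μ : YoungDiagram}, μ.card = n →
    ∑ ν ∈ (diagrams (n + 1)).filter (μ ≤ ·), numSYT ν = (n + 1) * numSYT μ := by
  induction n with
  | zero =>
    intro μ hμ
    obtain rfl := eq_bot_of_card hμ
    have hd : ∀ ν ∈ (diagrams (0 + 1)).filter ((⊥ : YoungDiagram) ≤ ·), numSYT ν = 1 := by
      intro ν hν
      rw [Finset.mem_filter, mem_diagrams] at hν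
      rw [numSYT_branching 0 hν.1]
      have : (diagrams 0).filter (· ≤ ν) = {⊥} := by
        ext κ
        rw [Finset.mem_filter, mem_diagrams, Finset.mem_singleton]
        constructor
        · exact fun h => eq_bot_of_card h.1
        · rintro rfl
          exact ⟨hμ, bot_le⟩
      rw [this, Finset.sum_singleton, numSYT_bot]
    rw [Finset.sum_congr rfl hd, Finset.sum_const, card_up hμ, numSYT_bot]
    have : cornerRows (⊥ : YoungDiagram) = ∅ := by simp [cornerRows]
    simp [this]
  | succ n ih =>
    intro μ hμ
    have hU : ∑ ν ∈ (diagrams (n + 1 + 1)).filter (μ ≤ ·), numSYT ν =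
        ∑ κ ∈ diagrams (n + 1),
          ((diagrams (n + 2)).filter (fun ν => μ ≤ ν ∧ κ ≤ ν)).card * numSYT κ := by
      rw [Finset.sum_congr rfl (fun ν hν =>
        numSYT_branching (n + 1) (mem_diagrams.1 (Finset.mem_filter.1 hν).1))]
      simp only [Finset.sum_filter]
      simp only [Finset.card_filter, Finset.sum_mul, ite_mul, one_mul, zero_mul]
      rw [Finset.sum_comm (s := diagrams (n + 1))]
      refine Finset.sum_congr rfl fun ν _ => ?_
      by_cases h : μ ≤ ν <;> simp [h]
    have hD : ∑ κ ∈ (diagrams n).filter (· ≤ μ), (n + 1) * numSYT κ =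
        ∑ κ ∈ diagrams (n + 1),
          ((diagrams n).filter (fun ν => ν ≤ μ ∧ ν ≤ κ)).card * numSYT κ := by
      rw [Finset.sum_congr rfl (fun κ hκ =>
        (ih (mem_diagrams.1 (Finset.mem_filter.1 hκ).1)).symm)]
      simp only [Finset.sum_filter]
      simp only [Finset.card_filter, Finset.sum_mul, ite_mul, one_mul, zero_mul]
      rw [Finset.sum_comm (s := diagrams (n + 1))]
      refine Finset.sum_congr rfl fun ν _ => ?_
      by_cases h : ν ≤ μ <;> simp [h]
    have hmem : μ ∈ diagrams (n + 1) := mem_diagrams.2 hμ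
    rw [← Finset.mul_sum, ← numSYT_branching n hμ] at hD
    rw [hU, ← Finset.add_sum_erase _ _ hmem]
    rw [← Finset.add_sum_erase _ _ hmem] at hD
    simp only [and_self] at hD ⊢
    rw [card_up hμ]
    rw [card_down hμ] at hD
    rw [Finset.sum_congr rfl (fun κ hκ => by
      rw [card_common_up_eq_down hμ (mem_diagrams.1 (Finset.mem_of_mem_erase hκ))
        (Finset.ne_of_mem_erase hκ)])]
    linarith

theorem numSYT_pos (μ : YoungDiagram) : 0 < numSYT μ := by
  classical
  induction h : μ.card generalizing μ with
  | zero => rw [eq_bot_of_card h, numSYT_bot]; exact one_pos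
  | succ n ih =>
    rw [numSYT_branching n h]
    refine Finset.sum_pos (fun κ hκ => ih κ (mem_diagrams.1 (Finset.mem_filter.1 hκ).1)) ?_
    rw [← Finset.card_pos, card_down h, Finset.card_pos]
    by_contra hne
    rw [Finset.not_nonempty_iff_eq_empty] at hne
    have hconst : ∀ i, μ.rowLen 0 ≤ μ.rowLen i := fun i => by
      induction i with
      | zero => exact le_rfl
      | succ k ihk =>
        have : k ∉ cornerRows μ := by simp [hne]
        rw [mem_cornerRows] at this
        omega
    obtain ⟨k, hk⟩ := μ.exists_notMem_col 0
    rw [YoungDiagram.mem_cells, YoungDiagram.mem_iff_lt_rowLen] at hk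
    have h0 : μ.rowLen 0 = 0 := by have := hconst k; omega
    obtain ⟨⟨a, b⟩, hab⟩ : μ.cells.Nonempty := by
      rw [← Finset.card_pos]
      have : μ.cells.card = n + 1 := h
      omega
    have h1 := YoungDiagram.mem_iff_lt_rowLen.1 hab
    have := μ.rowLen_anti 0 a (Nat.zero_le _)
    omega


/-! ### The Plancherel growth process -/

open Classical in
/-- Transition probabilities of the Plancherel growth process: from `μ` with `n` boxes to `ν` with
probability `f^ν / ((n + 1) f^μ)` if `μ ↗ ν`, and `0` otherwise. -/
noncomputable def transitionProb (μ ν : YoungDiagram) : ℝ≥0∞ :=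
  if Adds μ ν then (numSYT ν : ℝ≥0∞) / (((μ.card + 1 : ℕ) : ℝ≥0∞) * (numSYT μ : ℝ≥0∞)) else 0

theorem hasSum_transitionProb (μ : YoungDiagram) : HasSum (transitionProb μ) 1 := by
  classical
  have hz : ∀ ν, ν ∉ (diagrams (μ.card + 1)).filter (μ ≤ ·) → transitionProb μ ν = 0 := by
    intro ν hν
    rw [Finset.mem_filter, mem_diagrams] at hν
    exact if_neg fun h => hν ⟨h.2, h.1⟩
  have hsum : ∑ ν ∈ (diagrams (μ.card + 1)).filter (μ ≤ ·), transitionProb μ ν = 1 := by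
    have h1 : ∀ ν ∈ (diagrams (μ.card + 1)).filter (μ ≤ ·), transitionProb μ ν =
        (numSYT ν : ℝ≥0∞) * (((μ.card + 1 : ℕ) : ℝ≥0∞) * (numSYT μ : ℝ≥0∞))⁻¹ := by
      intro ν hν
      rw [Finset.mem_filter, mem_diagrams] at hν
      rw [transitionProb, if_pos ⟨hν.2, hν.1⟩, div_eq_mul_inv]
    rw [Finset.sum_congr rfl h1, ← Finset.sum_mul, ← Nat.cast_sum, sum_numSYT_up _ rfl,
      ← Nat.cast_mul]
    refine ENNReal.mul_inv_cancel ?_ (ENNReal.natCast_ne_top _)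
    have := numSYT_pos μ
    exact_mod_cast (by positivity : (μ.card + 1) * numSYT μ ≠ 0)
  rw [← hsum]
  exact hasSum_sum_of_ne_finset_zero hz

instance : MeasurableSpace YoungDiagram := ⊤

instance : DiscreteMeasurableSpace YoungDiagram := ⟨fun _ => trivial⟩

instance : Countable YoungDiagram :=
  Function.Injective.countable (f := YoungDiagram.cells) fun _ _ h => YoungDiagram.ext h

/-- The distribution of the diagram that follows `μ` in the Plancherel growth process. -/
noncomputable def transitionPMF (μ : YoungDiagram) : PMF YoungDiagram :=
  ⟨transitionProb μ, hasSum_transitionProb μ⟩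

/-- The Markov kernel of the Plancherel growth process. -/
noncomputable def transitionKernel : Kernel YoungDiagram YoungDiagram :=
  Kernel.ofFunOfCountable fun μ => (transitionPMF μ).toMeasure

instance : IsMarkovKernel transitionKernel :=
  ⟨fun μ => inferInstanceAs (IsProbabilityMeasure (transitionPMF μ).toMeasure)⟩

/-- The transition kernels as functions of the whole history, which only use the present state. -/
noncomputable def historyKernel (n : ℕ) :
    Kernel ((i : Finset.Iic n) → (fun _ : ℕ => YoungDiagram) i) YoungDiagram :=
  transitionKernel.comap (fun h => h ⟨n, Finset.mem_Iic.2 le_rfl⟩) (measurable_pi_apply _)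

instance (n : ℕ) : IsMarkovKernel (historyKernel n) := by
  unfold historyKernel; infer_instance

/-- The law, on sequences of diagrams, of the Plancherel growth process `∅ = Λ₀ ↗ Λ₁ ↗ Λ₂ ↗ ⋯`:
the Markov chain started at the empty diagram with the above transition probabilities. -/
noncomputable def plancherelGrowth : Measure (ℕ → YoungDiagram) :=
  Kernel.trajMeasure (X := fun _ => YoungDiagram) (Measure.dirac ⊥) historyKernel

/-! ### Infinite Young tableaux -/

/-- An infinite Young tableau: a filling of the boxes of the quadrant by the numbers `1, 2, 3, …`,
each appearing exactly once, increasing along rows and columns. Boxes are indexed from `(0, 0)`;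
the first coordinate is the row and the second the column, as for `YoungDiagram`. -/
@[ext]
structure InfiniteTableau where
  entry : ℕ × ℕ → ℕ
  bijOn : Set.BijOn entry Set.univ (Set.Ici 1)
  row_lt : ∀ i j, entry (i, j) < entry (i, j + 1)
  col_lt : ∀ i j, entry (i, j) < entry (i + 1, j)

namespace InfiniteTableau

/-- The smallest σ-algebra making all coordinates `t ↦ t_{i,j}` measurable. -/
instance : MeasurableSpace InfiniteTableau :=
  ⨆ c : ℕ × ℕ, MeasurableSpace.comap (fun t : InfiniteTableau => t.entry c) ⊤

instance : Inhabited InfiniteTableau where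
  default :=
    { entry := fun c => Nat.pair c.1 c.2 + 1
      bijOn := by
        refine ⟨fun c _ => ?_, fun c _ d _ h => ?_, fun n hn => ?_⟩
        · simp
        · have h1 : Nat.pair c.1 c.2 = Nat.pair d.1 d.2 := by simpa using h
          obtain ⟨h2, h3⟩ := Nat.pair_eq_pair.1 h1
          exact Prod.ext h2 h3
        · refine ⟨Nat.unpair (n - 1), trivial, ?_⟩
          have : 1 ≤ n := hn
          simp only [Nat.pair_unpair]
          omega
      row_lt := fun i j => Nat.succ_lt_succ (Nat.pair_lt_pair_right i (Nat.lt_succ_self j))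
      col_lt := fun i j => Nat.succ_lt_succ (Nat.pair_lt_pair_left j (Nat.lt_succ_self i)) }

variable (t : InfiniteTableau)

theorem injective : Function.Injective t.entry := fun _ _ h =>
  t.bijOn.injOn trivial trivial h

theorem one_le (c : ℕ × ℕ) : 1 ≤ t.entry c := t.bijOn.mapsTo trivial

theorem mono {c d : ℕ × ℕ} (h : c ≤ d) : t.entry c ≤ t.entry d := by
  obtain ⟨i, j⟩ := c
  obtain ⟨i', j'⟩ := d
  obtain ⟨hi, hj⟩ := Prod.mk_le_mk.1 h
  have h1 : Monotone fun a => t.entry (a, j) := monotone_nat_of_le_succ fun a => (t.col_lt a j).le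
  have h2 : Monotone fun b => t.entry (i', b) := monotone_nat_of_le_succ fun b => (t.row_lt i' b).le
  exact (h1 hi).trans (h2 hj)

theorem finite_le (n : ℕ) : {c | t.entry c ≤ n}.Finite :=
  Set.Finite.preimage t.injective.injOn (Set.finite_Iic n)

/-- The diagram `Λ_n` consisting of the boxes of `t` with entry at most `n`. -/
noncomputable def shape (n : ℕ) : YoungDiagram where
  cells := (t.finite_le n).toFinset
  isLowerSet := by
    intro c d h hc
    simp only [Set.Finite.coe_toFinset, Set.mem_ofPred_eq] at hc ⊢
    exact (t.mono h).trans hc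

/-- The path in the Young graph of which `t` is the recording tableau. -/
noncomputable def shapePath : ℕ → YoungDiagram := fun n => t.shape n

/-! ### Jeu de taquin -/

/-- The jeu de taquin path of `t`: start at the corner and always step to that one of the two
neighbouring boxes (next row or next column) whose entry is smaller. -/
def jdtPath : ℕ → ℕ × ℕ
  | 0 => (0, 0)
  | k + 1 =>
    let c := jdtPath k
    if t.entry (c.1 + 1, c.2) < t.entry (c.1, c.2 + 1) then (c.1 + 1, c.2) else (c.1, c.2 + 1)

open Classical in
/-- The entries of `J(t)`: at the `k`-th box of the jeu de taquin path it is the entry of `t` at the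
`(k+1)`-st box of the path, minus one; elsewhere it is the entry of `t` minus one. -/
noncomputable def jdtEntry (c : ℕ × ℕ) : ℕ :=
  if h : ∃ k, t.jdtPath k = c then t.entry (t.jdtPath (h.choose + 1)) - 1 else t.entry c - 1

theorem jdtPath_sum (k : ℕ) : (t.jdtPath k).1 + (t.jdtPath k).2 = k := by
  induction k with
  | zero => rfl
  | succ k ih =>
    rw [jdtPath]
    split_ifs <;> simp only <;> omega

theorem jdtPath_injective : Function.Injective t.jdtPath := fun k l h => by
  rw [← t.jdtPath_sum k, ← t.jdtPath_sum l, h]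

theorem jdtEntry_path (k : ℕ) : t.jdtEntry (t.jdtPath k) = t.entry (t.jdtPath (k + 1)) - 1 := by
  have h : ∃ l, t.jdtPath l = t.jdtPath k := ⟨k, rfl⟩
  rw [jdtEntry, dif_pos h, t.jdtPath_injective h.choose_spec]

theorem jdtEntry_off {c : ℕ × ℕ} (hc : ∀ k, t.jdtPath k ≠ c) : t.jdtEntry c = t.entry c - 1 :=
  dif_neg fun ⟨k, hk⟩ => hc k hk

theorem entry_jdtPath_succ_le_row (k : ℕ) :
    t.entry (t.jdtPath (k + 1)) ≤ t.entry ((t.jdtPath k).1, (t.jdtPath k).2 + 1) := by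
  rw [jdtPath]
  split_ifs with h
  · exact h.le
  · exact le_rfl

theorem entry_jdtPath_succ_le_col (k : ℕ) :
    t.entry (t.jdtPath (k + 1)) ≤ t.entry ((t.jdtPath k).1 + 1, (t.jdtPath k).2) := by
  rw [jdtPath]
  split_ifs with h
  · exact le_rfl
  · exact not_lt.1 h

theorem entry_jdtPath_lt (k : ℕ) : t.entry (t.jdtPath k) < t.entry (t.jdtPath (k + 1)) := by
  conv_rhs => rw [jdtPath]
  split_ifs with h
  · exact t.col_lt _ _
  · exact t.row_lt _ _

theorem entry_zero_lt {c : ℕ × ℕ} (hc : c ≠ (0, 0)) : t.entry (0, 0) < t.entry c :=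
  lt_of_le_of_ne (t.mono ⟨Nat.zero_le _, Nat.zero_le _⟩) fun h => hc (t.injective h).symm

theorem entry_zero : t.entry (0, 0) = 1 := by
  obtain ⟨c, -, hc⟩ := t.bijOn.surjOn (Set.mem_Ici.2 (le_refl 1))
  by_contra hne
  have h1 : c ≠ (0, 0) := fun h => hne (h ▸ hc)
  have h2 := t.entry_zero_lt h1
  have h3 := t.one_le (0, 0)
  omega

/-- `J(t)_c + 1` is the entry of `t` at some box other than the corner. -/
theorem exists_source (c : ℕ × ℕ) :
    ∃ d, d ≠ (0, 0) ∧ t.jdtEntry c + 1 = t.entry d ∧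
      ((∃ k, t.jdtPath k = c ∧ t.jdtPath (k + 1) = d) ∨ ((∀ k, t.jdtPath k ≠ c) ∧ d = c)) := by
  by_cases h : ∃ k, t.jdtPath k = c
  · obtain ⟨k, rfl⟩ := h
    refine ⟨t.jdtPath (k + 1), fun h0 => ?_, ?_, Or.inl ⟨k, rfl, rfl⟩⟩
    · have := t.jdtPath_sum (k + 1)
      rw [h0] at this
      simp at this
    · rw [t.jdtEntry_path]
      have := t.one_le (t.jdtPath (k + 1))
      omega
  · push Not at h
    refine ⟨c, fun h0 => h 0 h0.symm, ?_, Or.inr ⟨h, rfl⟩⟩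
    rw [t.jdtEntry_off h]
    have := t.one_le c
    omega

theorem le_jdtEntry (c : ℕ × ℕ) : t.entry c ≤ t.jdtEntry c + 1 := by
  obtain ⟨d, -, h, ⟨k, rfl, rfl⟩ | ⟨-, rfl⟩⟩ := t.exists_source c
  · rw [h]; exact (t.entry_jdtPath_lt k).le
  · exact h.ge

theorem jdtEntry_lt_of {c d : ℕ × ℕ} (hlt : t.entry c < t.entry d)
    (hp : ∀ k, t.jdtPath k = c → t.entry (t.jdtPath (k + 1)) ≤ t.entry d) :
    t.jdtEntry c < t.jdtEntry d := by
  have hd := t.le_jdtEntry d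
  obtain ⟨e, -, h, ⟨k, rfl, rfl⟩ | ⟨-, rfl⟩⟩ := t.exists_source c
  · have h1 := hp k rfl
    rcases eq_or_lt_of_le h1 with h2 | h2
    · obtain rfl := t.injective h2
      rw [t.jdtEntry_path (k + 1)]
      have := t.entry_jdtPath_lt (k + 1)
      omega
    · omega
  · omega

/-- The jeu de taquin map `J` on infinite Young tableaux. -/
noncomputable def jdt : InfiniteTableau where
  entry := t.jdtEntry
  bijOn := by
    refine ⟨fun c _ => ?_, fun c _ c' _ h => ?_, fun n hn => ?_⟩
    · obtain ⟨d, hd, h, -⟩ := t.exists_source c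
      have := t.entry_zero_lt hd
      rw [t.entry_zero] at this
      exact Set.mem_Ici.2 (by omega)
    · obtain ⟨d, -, h1, h2⟩ := t.exists_source c
      obtain ⟨d', -, h1', h2'⟩ := t.exists_source c'
      obtain rfl : d = d' := t.injective (by rw [← h1, ← h1', h])
      rcases h2 with ⟨k, rfl, hk⟩ | ⟨hk, rfl⟩ <;> rcases h2' with ⟨l, rfl, hl⟩ | ⟨hl, hd⟩
      · have := t.jdtPath_injective (hk.trans hl.symm)
        obtain rfl : k = l := by omega
        rfl
      · exact absurd (hk.trans hd) (hl _)
      · exact absurd hl (hk _)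
      · exact hd
    · have hn' : 1 ≤ n := hn
      obtain ⟨d, -, hd⟩ := t.bijOn.surjOn (Set.mem_Ici.2 (Nat.le_add_left 1 n))
      by_cases h : ∃ k, t.jdtPath k = d
      · obtain ⟨k, rfl⟩ := h
        rcases k with _ | k
        · have h0 : t.entry (0, 0) = n + 1 := hd
          rw [t.entry_zero] at h0
          omega
        · exact ⟨t.jdtPath k, trivial, by rw [t.jdtEntry_path, hd]; rfl⟩
      · push Not at h
        exact ⟨d, trivial, by rw [t.jdtEntry_off h, hd]; rfl⟩
  row_lt := fun i j => t.jdtEntry_lt_of (t.row_lt i j) fun k hk => by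
    have := t.entry_jdtPath_succ_le_row k
    rwa [hk] at this
  col_lt := fun i j => t.jdtEntry_lt_of (t.col_lt i j) fun k hk => by
    have := t.entry_jdtPath_succ_le_col k
    rwa [hk] at this

end InfiniteTableau

/-- The Plancherel measure `P` on infinite Young tableaux: the law of the Plancherel growth process,
transported along the identification of infinite tableaux with the paths in the Young graph which
start at the empty diagram and eventually contain every box. -/
noncomputable def plancherelMeasure : Measure InfiniteTableau :=
  plancherelGrowth.comap InfiniteTableau.shapePath

/-! ### The infinite Robinson–Schensted–Knuth map -/

section RSK

variable {α : Type*} [LinearOrder α]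

/-- Insert `x` into an increasing row: `x` replaces the first entry larger than `x`, which is bumped
out (second component of the result); if there is none, `x` is appended to the row. -/
def rowInsert (x : α) : List α → List α × Option α
  | [] => ([x], none)
  | y :: r =>
    if x < y then (x :: r, some y) else (y :: (rowInsert x r).1, (rowInsert x r).2)

/-- Row insertion of `x` into a tableau, given as the list of its rows: insert `x` into the first
row, the bumped entry into the second row, and so on. -/
def insertStep (x : α) : List (List α) → List (List α)
  | [] => [[x]]
  | r :: P =>
    match (rowInsert x r).2 with
    | none => (rowInsert x r).1 :: P
    | some y => (rowInsert x r).1 :: insertStep y P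

/-- The insertion tableau `P_n` of the first `n` terms of the sequence `x`. -/
def insertionTableau (x : ℕ → α) : ℕ → List (List α)
  | 0 => []
  | n + 1 => insertStep (x n) (insertionTableau x n)

/-- The boxes of the RSK shape `λ_n` associated with the first `n` terms of the sequence `x`. -/
def rskShape (x : ℕ → α) (n : ℕ) : Set (ℕ × ℕ) :=
  {c | c.2 < ((insertionTableau x n).getD c.1 []).length}

/-- `t` is the infinite recording tableau of `x`: for every `n`, the boxes of `t` with entry at
most `n` are those of the RSK shape `λ_n`. -/
def IsRecordingTableau (x : ℕ → α) (t : InfiniteTableau) : Prop :=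
  ∀ n c, t.entry c ≤ n ↔ c ∈ rskShape x n

/-- The sequences on which the infinite RSK map is defined: the terms are distinct and the path of
RSK shapes has an infinite recording tableau. -/
def rskDomain : Set (ℕ → α) :=
  {x | Function.Injective x ∧ ∃ t, IsRecordingTableau x t}

open Classical in
/-- The infinite RSK map, sending a sequence in `rskDomain` to its infinite recording tableau (and
any other sequence to a fixed arbitrary tableau). -/
noncomputable def rsk (x : ℕ → α) : InfiniteTableau :=
  if h : x ∈ rskDomain then h.2.choose else default

end RSK

/-- The product measure `Leb^{⊗ℕ}` on `[0,1]^ℕ`. -/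
noncomputable def lebProduct : Measure (ℕ → unitInterval) :=
  Measure.infinitePi fun _ => (volume : Measure unitInterval)

/-- The one-sided shift `S(x₁, x₂, …) = (x₂, x₃, …)`. -/
def shift {α : Type*} (x : ℕ → α) : ℕ → α := fun n => x (n + 1)

end JeuDeTaquin

/-! Two facts about Robinson–Schensted shapes carry the theorem: deleting the first term of a
sequence acts on its recording tableau by jeu de taquin (`isRecordingTableau_shift`), and the shapes
of an i.i.d. uniform sequence form the Plancherel growth process (`map_rskPath`). Hence `rsk`
carries `lebProduct` to `plancherelMeasure` and intertwines `shift` with `jdt`. Measure preservation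
and ergodicity hold for the i.i.d. shift, the latter by Kolmogorov's zero-one law, and they pass to
the factor.

The first fact is proved with shapes alone. Prepending a letter `x`, appending a letter `y` and
putting in a largest letter `m` are the three directions of a cube of shapes. Its faces obey local
rules: `RowSquare` for `y` and `m`, `ColSquare` for `x` and `m`, `JdtSquare` for `x` and `y`. By
`cube`, the faces without `m` and without `y`, together with the two row faces, force the remaining
two. Induction on the length of the word then gives the jeu de taquin rule for all words without
repetitions (`jdtSquare_and_colSquare_wordShape`). Along a sequence this rule says that the box by
which the shape with the first term exceeds the shape without it runs through the jeu de taquin path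
(`exists_jdtPath_eq`).

For the second fact, a word is recovered from its insertion tableau and the shapes of its prefixes.
So at most `f^μ` of the `n!` equally likely orderings produce a given path ending in `μ`, while the
growth process gives that path mass exactly `f^μ / n!`. Both laws have total mass one, so the
inequality is an equality, and surjectivity of the Robinson–Schensted correspondence is not needed.

That almost surely every box gets filled also comes from ergodicity of the shift. The event that a
given box is filled contains its shift preimage up to a null set, hence has probability zero or one,
and some finite path through the box has positive mass (`ae_exists_mem_rskPath`). -/

namespace JeuDeTaquin

/-! ### Local rules for shapes -/

/-- Add a box at the end of row `p` of the shape with row lengths `l`. -/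
def bump (l : ℕ → ℕ) (p : ℕ) (i : ℕ) : ℕ := l i + if i = p then 1 else 0

theorem bump_comm (l : ℕ → ℕ) (p q : ℕ) : bump (bump l p) q = bump (bump l q) p := by
  funext i; simp only [bump]; omega

theorem bump_injective (l : ℕ → ℕ) : Function.Injective (bump l) := by
  intro p q h
  by_contra hne
  have := congrFun h p
  simp [bump, hne] at this

/-- The local rule of row insertion: `m` is obtained from `l`, and `m'` from `l'`, by adding the
largest letter, while the steps from `l` to `l'` and from `m` to `m'` insert the same letter. -/
def RowSquare (l l' m m' : ℕ → ℕ) : Prop :=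
  ∃ b v e, l' = bump l b ∧ m = bump l v ∧ m' = bump l' e ∧
    (b ≠ v → e = v) ∧ (b = v → e = b + 1)

/-- The local rule of column insertion: the steps from `l` to `A` and from `l'` to `A'` insert the
same letter, while `l'` is obtained from `l`, and `A'` from `A`, by adding the largest letter. -/
def ColSquare (l A l' A' : ℕ → ℕ) : Prop :=
  ∃ c v f, A = bump l c ∧ l' = bump l v ∧ A' = bump A f ∧
    (c ≠ v → f = v) ∧ (c = v → bump l c f = l c + 1)

/-- The local rule of jeu de taquin: the box of `A` outside `l` stays in place unless `l'` contains
it, in which case it moves to an adjacent box. -/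
def JdtSquare (l A l' A' : ℕ → ℕ) : Prop :=
  ∃ c b d, A = bump l c ∧ l' = bump l b ∧ A' = bump A d ∧
    (b ≠ c → d = b) ∧ (b = c → d = c ∨ d = c + 1 ∧ l (c + 1) = l c)

theorem RowSquare.antitone {l l' m m' : ℕ → ℕ} (h : RowSquare l l' m m') (hl : Antitone l)
    (hl' : Antitone l') (hm : Antitone m) : Antitone m' := by
  obtain ⟨b, v, e, rfl, rfl, rfl, h1, h2⟩ := h
  refine antitone_nat_of_succ_le fun i => ?_
  have a1 := hl (Nat.le_succ i)
  have a2 := hl' (Nat.le_succ i)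
  have a3 := hm (Nat.le_succ i)
  by_cases hbv : b = v
  · obtain rfl := h2 hbv
    simp only [bump, Nat.succ_eq_add_one] at *
    grind
  · obtain rfl := h1 hbv
    simp only [bump, Nat.succ_eq_add_one] at *
    grind

/-- The cube whose faces are the local rules of row insertion, column insertion and jeu de taquin
closes up. -/
theorem cube {l00 l10 l01 l11 A00 A10 A01 A11 : ℕ → ℕ}
    (hl10 : Antitone l10) (hl01 : Antitone l01)
    (hA00 : Antitone A00) (hA10 : Antitone A10) (hA01 : Antitone A01)
    (hJ : JdtSquare l00 A00 l10 A10) (hC : ColSquare l00 A00 l01 A01)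
    (hl : RowSquare l00 l10 l01 l11) (hA : RowSquare A00 A10 A01 A11) :
    JdtSquare l01 A01 l11 A11 ∧ ColSquare l10 A10 l11 A11 := by
  obtain ⟨c, b, d, rfl, rfl, rfl, hJ1, hJ2⟩ := hJ
  obtain ⟨c', v, f, hc', rfl, rfl, hC1, hC2⟩ := hC
  obtain rfl := bump_injective _ hc'
  obtain ⟨b', v', e, hb', hv', rfl, hl1, hl2⟩ := hl
  obtain rfl := bump_injective _ hb'
  obtain rfl := bump_injective _ hv'
  obtain ⟨d', f', e', hd', hf', rfl, hA1, hA2⟩ := hA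
  obtain rfl := bump_injective _ hd'
  obtain rfl := bump_injective _ hf'
  generalize l00 = l at *
  -- The cases are the coincidences among the rows `b`, `c`, `v` in which `l10`, `A00`, `l01` exceed
  -- `l`, and among the rows `d`, `f` in which `A10`, `A01` exceed `A00`. Monotonicity of the shapes
  -- excludes the incompatible combinations.
  rcases eq_or_ne b c with rfl | hbc
  · specialize hJ2 rfl
    rcases eq_or_ne b v with rfl | hbv
    · specialize hC2 rfl
      obtain rfl := hl2 rfl
      rcases hJ2 with rfl | ⟨rfl, hcol⟩
      · have hfd : f = d := by
          rcases lt_trichotomy f d with h | h | h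
          · have := hA10 h.le
            simp only [bump] at *
            grind
          · exact h
          · have := hA01 h.le
            simp only [bump] at *
            grind
        subst hfd
        obtain rfl := hA2 rfl
        refine ⟨⟨f, f + 1, f + 1, rfl, rfl, rfl, fun _ => rfl, fun h => ?_⟩,
          ⟨f, f + 1, f + 1, rfl, rfl, rfl, fun _ => rfl, fun h => ?_⟩⟩ <;> omega
      · have hfd : b + 1 ≠ f := by
          rintro rfl
          simp only [bump] at *
          grind
        obtain rfl := hA1 hfd
        refine ⟨⟨e', b + 1, b + 1, rfl, rfl, bump_comm _ _ _, fun _ => rfl, fun h => ?_⟩,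
          ⟨b + 1, b + 1, e', rfl, rfl, rfl, fun h => absurd rfl h, fun h => ?_⟩⟩
        · exact absurd h hfd
        · simp only [bump] at *
          grind
    · obtain rfl := hC1 hbv
      obtain rfl := hl1 hbv
      have hde : d ≠ e := by
        rintro rfl
        have a1 := hl01 (Nat.le_succ b)
        rcases hJ2 with rfl | ⟨rfl, h⟩
        · exact hbv rfl
        · simp only [bump] at *
          grind
      obtain rfl := hA1 hde
      refine ⟨⟨b, b, d, bump_comm _ _ _, bump_comm _ _ _, bump_comm _ _ _, fun h => absurd rfl h,
        fun _ => ?_⟩, ⟨d, e', e', rfl, rfl, rfl, fun _ => rfl, fun h => absurd h hde⟩⟩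
      rcases hJ2 with rfl | ⟨rfl, h⟩
      · exact Or.inl rfl
      · refine Or.inr ⟨rfl, ?_⟩
        simp only [bump]
        grind
  · obtain rfl := hJ1 hbc
    rcases eq_or_ne c v with rfl | hcv
    · specialize hC2 rfl
      obtain rfl := hl1 hbc
      rcases eq_or_ne d f with rfl | hdf
      · obtain rfl := hA2 rfl
        refine ⟨⟨d, d, d + 1, rfl, bump_comm _ _ _, ?_, fun h => absurd rfl h, fun _ => ?_⟩,
          ⟨e, e, d + 1, bump_comm _ _ _, rfl, rfl, fun h => absurd rfl h, fun _ => ?_⟩⟩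
        · rfl
        · have a0 : d < e := by
            by_contra h
            have := hA00 (show e ≤ d by omega)
            have := hl10 (show e ≤ d by omega)
            simp only [bump] at *
            grind
          have a1 := hA00 (show d + 1 ≤ e by omega)
          have a2 := hA00 (Nat.le_succ d)
          refine Or.inr ⟨rfl, ?_⟩
          simp only [bump] at *
          grind
        · have a0 : d < e := by
            by_contra h
            have := hA00 (show e ≤ d by omega)
            have := hl10 (show e ≤ d by omega)
            simp only [bump] at *
            grind
          have a1 := hA00 (show d + 1 ≤ e by omega)
          have a2 := hA00 (Nat.le_succ d)
          simp only [bump] at *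
          grind
      · obtain rfl := hA1 hdf
        refine ⟨⟨e', d, d, rfl, bump_comm _ _ _, bump_comm _ _ _, fun _ => rfl, fun h => absurd h hdf⟩,
          ⟨e, e, e', bump_comm _ _ _, rfl, rfl, fun h => absurd rfl h, fun _ => ?_⟩⟩
        simp only [bump] at *
        grind
    · obtain rfl := hC1 hcv
      rcases eq_or_ne d f with rfl | hdv
      · obtain rfl := hA2 rfl
        obtain rfl := hl2 rfl
        rcases eq_or_ne c (d + 1) with rfl | hcd
        · refine ⟨⟨d + 1, d + 1, d + 1, bump_comm _ _ _, rfl, rfl, fun _ => rfl,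
            fun _ => Or.inl rfl⟩,
            ⟨d + 1, d + 1, d + 1, bump_comm _ _ _, rfl, rfl, fun _ => rfl, fun _ => ?_⟩⟩
          simp only [bump]
          grind
        · refine ⟨⟨c, d + 1, d + 1, bump_comm _ _ _, rfl, rfl, fun _ => rfl,
            fun h => absurd h.symm hcd⟩,
            ⟨c, d + 1, d + 1, bump_comm _ _ _, rfl, rfl, fun _ => rfl, fun h => absurd h hcd⟩⟩
      · obtain rfl := hl1 hdv
        obtain rfl := hA1 hdv
        refine ⟨⟨c, d, d, bump_comm _ _ _, bump_comm _ _ _, bump_comm _ _ _, fun _ => rfl,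
            fun h => absurd h hbc⟩,
            ⟨c, e', e', bump_comm _ _ _, rfl, rfl, fun _ => rfl, fun h => absurd h hcv⟩⟩

/-! ### Row insertion and the largest letter -/

section Insertion

variable {α : Type*}

/-- The lengths of the rows of a tableau given as the list of its rows. -/
def rowLens (T : List (List α)) (i : ℕ) : ℕ := (T.getD i []).length

@[simp] theorem rowLens_cons_zero (r : List α) (T : List (List α)) :
    rowLens (r :: T) 0 = r.length := rfl

@[simp] theorem rowLens_cons_succ (r : List α) (T : List (List α)) (i : ℕ) :
    rowLens (r :: T) (i + 1) = rowLens T i := rfl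

@[simp] theorem rowLens_nil (i : ℕ) : rowLens ([] : List (List α)) i = 0 := rfl

/-- Append `m` to row `p`. -/
def addAt (m : α) : ℕ → List (List α) → List (List α)
  | 0, [] => [[m]]
  | 0, r :: T => (r ++ [m]) :: T
  | p + 1, [] => [] :: addAt m p []
  | p + 1, r :: T => r :: addAt m p T

theorem rowLens_addAt (m : α) (p : ℕ) (T : List (List α)) :
    rowLens (addAt m p T) = bump (rowLens T) p := by
  induction p generalizing T with
  | zero =>
    funext i
    cases T <;> cases i <;> simp [addAt, bump]
  | succ p ih =>
    funext i
    cases T <;> cases i <;> simp [addAt, bump, ih]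

variable [LinearOrder α]

theorem rowInsert_none {y : α} {r : List α} (h : (rowInsert y r).2 = none) :
    (rowInsert y r).1 = r ++ [y] := by
  induction r with
  | nil => rfl
  | cons a r ih =>
    rw [rowInsert] at h ⊢
    split_ifs at h ⊢
    simp_all

theorem rowInsert_some {y z : α} {r : List α} (h : (rowInsert y r).2 = some z) :
    ∃ s t, r = s ++ z :: t ∧ (rowInsert y r).1 = s ++ y :: t ∧ y < z ∧ ∀ a ∈ s, a ≤ y := by
  induction r with
  | nil => simp [rowInsert] at h
  | cons a r ih =>
    rw [rowInsert] at h ⊢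
    split_ifs at h ⊢ with hlt
    · simp only [Option.some.injEq] at h
      subst h
      exact ⟨[], r, rfl, rfl, hlt, by simp⟩
    · obtain ⟨s, t, h1, h2, h3, h4⟩ := ih h
      refine ⟨a :: s, t, by simp [← h1], by simp [h2], h3, ?_⟩
      simpa using ⟨not_lt.1 hlt, h4⟩

theorem rowInsert_eq_none {m : α} {r : List α} (h : ∀ a ∈ r, a < m) :
    rowInsert m r = (r ++ [m], none) := by
  induction r with
  | nil => rfl
  | cons a r ih =>
    simp only [List.mem_cons, forall_eq_or_imp] at h
    rw [rowInsert, if_neg h.1.not_gt, ih h.2]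
    rfl

theorem rowInsert_append_of_none {y m : α} {r : List α} (hy : y < m)
    (h : (rowInsert y r).2 = none) : rowInsert y (r ++ [m]) = (r ++ [y], some m) := by
  induction r with
  | nil => simp [rowInsert, hy]
  | cons a r ih =>
    rw [rowInsert] at h
    rw [List.cons_append, rowInsert]
    split_ifs at h ⊢
    simp [ih h]

theorem rowInsert_append_of_some {y z m : α} {r : List α}
    (h : (rowInsert y r).2 = some z) :
    rowInsert y (r ++ [m]) = ((rowInsert y r).1 ++ [m], some z) := by
  induction r with
  | nil => simp [rowInsert] at h
  | cons a r ih =>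
    rw [rowInsert] at h ⊢
    rw [List.cons_append, rowInsert]
    split_ifs at h ⊢
    · simp_all
    · simp [ih h]

theorem insertStep_cons_of_none {y : α} {r : List α} {T : List (List α)}
    (h : (rowInsert y r).2 = none) : insertStep y (r :: T) = (r ++ [y]) :: T := by
  rw [insertStep, h, rowInsert_none h]

theorem insertStep_cons_of_some {y z : α} {r : List α} {T : List (List α)}
    (h : (rowInsert y r).2 = some z) :
    insertStep y (r :: T) = (rowInsert y r).1 :: insertStep z T := by
  rw [insertStep, h]

theorem insertStep_max {m : α} {T : List (List α)} (h : ∀ r ∈ T, ∀ a ∈ r, a < m) :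
    insertStep m T = addAt m 0 T := by
  cases T with
  | nil => rfl
  | cons r T =>
    have := rowInsert_eq_none (h r (by simp))
    rw [insertStep_cons_of_none (by rw [this]), addAt]

/-- Insertion commutes with the presence of a letter `m` larger than all others, except that `m`
is bumped to the next row if the insertion path ends in its box. -/
theorem exists_insertStep_addAt {m y : α} (hy : y < m) {T : List (List α)}
    (h : ∀ r ∈ T, ∀ a ∈ r, a < m) :
    ∃ b, rowLens (insertStep y T) = bump (rowLens T) b ∧ ∀ p,
      insertStep y (addAt m p T) = addAt m (if b = p then p + 1 else p) (insertStep y T) := by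
  induction T generalizing y with
  | nil =>
    refine ⟨0, ?_, fun p => ?_⟩
    · funext i
      cases i <;> simp [insertStep, bump]
    · cases p with
      | zero =>
        have : (rowInsert y [m]) = ([y], some m) := rowInsert_append_of_none (r := []) hy rfl
        simp [addAt, insertStep, this]
      | succ p =>
        have : (rowInsert y []) = ([y], none) := rfl
        simp [addAt, insertStep, this]
  | cons r T ih =>
    simp only [List.mem_cons, forall_eq_or_imp] at h
    -- If `y` is appended to `r`, it bumps `m` exactly when `m` ends this row. If `y` bumps some
    -- `z`, it does so with or without `m` at the end of the row, and induction applies to `z < m`.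
    rcases hz : (rowInsert y r).2 with _ | z
    · refine ⟨0, ?_, fun p => ?_⟩
      · funext i
        rw [insertStep_cons_of_none hz]
        cases i <;> simp [bump]
      · cases p with
        | zero =>
          have h1 := rowInsert_append_of_none hy hz
          rw [addAt, insertStep_cons_of_some (by rw [h1]), h1, insertStep_cons_of_none hz,
            insertStep_max h.2]
          simp [addAt]
        | succ p =>
          rw [addAt, insertStep_cons_of_none hz, insertStep_cons_of_none hz]
          simp [addAt]
    · obtain ⟨s, t, h1, h2, -, -⟩ := rowInsert_some hz
      have hzm : z < m := h.1 z (by simp [h1])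
      obtain ⟨b, hb, hp⟩ := ih hzm h.2
      refine ⟨b + 1, ?_, fun p => ?_⟩
      · funext i
        rw [insertStep_cons_of_some hz, h2]
        cases i with
        | zero => simp [bump, h1]
        | succ i => simp [hb, bump]
      · cases p with
        | zero =>
          have h1 := rowInsert_append_of_some (m := m) hz
          rw [addAt, insertStep_cons_of_some (by rw [h1]), h1, insertStep_cons_of_some hz]
          simp [addAt]
        | succ p =>
          rw [addAt, insertStep_cons_of_some hz, insertStep_cons_of_some hz, hp]
          by_cases hbp : b = p <;> simp [addAt, hbp]

theorem mem_insertStep {y : α} {T : List (List α)} {r : List α} (hr : r ∈ insertStep y T) {a : α}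
    (ha : a ∈ r) : a = y ∨ ∃ s ∈ T, a ∈ s := by
  induction T generalizing y with
  | nil =>
    simp only [insertStep, List.mem_singleton] at hr
    subst hr
    simpa using ha
  | cons q T ih =>
    rcases hz : (rowInsert y q).2 with _ | z
    · rw [insertStep_cons_of_none hz, List.mem_cons] at hr
      rcases hr with rfl | hr
      · rcases List.mem_append.1 ha with h | h
        · exact Or.inr ⟨q, by simp, h⟩
        · exact Or.inl (by simpa using h)
      · exact Or.inr ⟨r, by simp [hr], ha⟩
    · obtain ⟨s, t, h1, h2, -, -⟩ := rowInsert_some hz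
      rw [insertStep_cons_of_some hz, List.mem_cons] at hr
      rcases hr with rfl | hr
      · rw [h2] at ha
        simp only [List.mem_append, List.mem_cons] at ha
        rcases ha with h | h | h
        · exact Or.inr ⟨q, by simp, by simp [h1, h]⟩
        · exact Or.inl h
        · exact Or.inr ⟨q, by simp, by simp [h1, h]⟩
      · rcases ih hr with rfl | ⟨s', hs', has⟩
        · exact Or.inr ⟨q, by simp, by simp [h1]⟩
        · exact Or.inr ⟨s', by simp [hs'], has⟩

/-- The insertion tableau of a word. -/
def insertWord (w : List α) : List (List α) := w.foldl (fun T y => insertStep y T) []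

@[simp] theorem insertWord_nil : insertWord ([] : List α) = [] := rfl

theorem insertWord_concat (w : List α) (y : α) :
    insertWord (w ++ [y]) = insertStep y (insertWord w) := by
  simp [insertWord]

theorem insertionTableau_eq (x : ℕ → α) (n : ℕ) :
    insertionTableau x n = insertWord ((List.range n).map x) := by
  induction n with
  | zero => rfl
  | succ n ih => rw [insertionTableau, ih, List.range_succ, List.map_append, List.map_singleton,
      insertWord_concat]

theorem mem_of_mem_insertWord {w : List α} {r : List α} (hr : r ∈ insertWord w) {a : α}
    (ha : a ∈ r) : a ∈ w := by
  induction w using List.reverseRecOn generalizing r with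
  | nil => simp at hr
  | append_singleton w y ih =>
    rw [insertWord_concat] at hr
    rcases mem_insertStep hr ha with rfl | ⟨s, hs, h⟩
    · simp
    · simp [ih hs h]

/-- The row lengths of the insertion tableau of a word. -/
def wordShape (w : List α) : ℕ → ℕ := rowLens (insertWord w)

/-- Each letter inserted after `m` either leaves `m` in place or pushes it down one row, and the
smaller letters never notice its presence. -/
theorem exists_insertWord_eq_addAt {m : α} {u s : List α} (hu : ∀ a ∈ u, a < m)
    (hs : ∀ a ∈ s, a < m) : ∃ p, insertWord (u ++ m :: s) = addAt m p (insertWord (u ++ s)) := by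
  induction s using List.reverseRecOn with
  | nil =>
    refine ⟨0, ?_⟩
    rw [insertWord_concat, List.append_nil,
      insertStep_max fun r hr a ha => hu a (mem_of_mem_insertWord hr ha)]
  | append_singleton s y ih =>
    simp only [List.mem_append, List.mem_singleton] at hs
    obtain ⟨p, hp⟩ := ih fun a ha => hs a (Or.inl ha)
    obtain ⟨b, -, hb⟩ := exists_insertStep_addAt (hs y (Or.inr rfl))
      (T := insertWord (u ++ s)) fun r hr a ha => by
        rcases List.mem_append.1 (mem_of_mem_insertWord hr ha) with h | h
        · exact hu a h
        · exact hs a (Or.inl h)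
    refine ⟨if b = p then p + 1 else p, ?_⟩
    rw [← List.cons_append, ← List.append_assoc, insertWord_concat, hp, hb, ← insertWord_concat,
      List.append_assoc]

theorem rowSquare_wordShape {m y : α} {u s : List α} (hu : ∀ a ∈ u, a < m)
    (hs : ∀ a ∈ s, a < m) (hy : y < m) :
    RowSquare (wordShape (u ++ s)) (wordShape (u ++ (s ++ [y]))) (wordShape (u ++ m :: s))
      (wordShape (u ++ m :: (s ++ [y]))) := by
  obtain ⟨p, hp⟩ := exists_insertWord_eq_addAt hu hs
  obtain ⟨b, hb, hb'⟩ := exists_insertStep_addAt hy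
      (T := insertWord (u ++ s)) fun r hr a ha => by
        rcases List.mem_append.1 (mem_of_mem_insertWord hr ha) with h | h
        · exact hu a h
        · exact hs a h
  refine ⟨b, p, if b = p then p + 1 else p, ?_, ?_, ?_, fun h => if_neg h, fun h => ?_⟩
  · rw [wordShape, ← List.append_assoc, insertWord_concat, hb, wordShape]
  · rw [wordShape, hp, rowLens_addAt, wordShape]
  · rw [wordShape, ← List.cons_append, ← List.append_assoc, insertWord_concat, hp, hb',
      rowLens_addAt, wordShape, ← List.append_assoc, insertWord_concat]
  · rw [if_pos h, h]

theorem wordShape_concat_max {m : α} {u : List α} (hu : ∀ a ∈ u, a < m) :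
    wordShape (u ++ [m]) = bump (wordShape u) 0 := by
  rw [wordShape, insertWord_concat,
    insertStep_max fun r hr a ha => hu a (mem_of_mem_insertWord hr ha), rowLens_addAt, wordShape]

theorem exists_max_split {w : List α} (hw : w.Nodup) (hne : w ≠ []) :
    ∃ m u s, w = u ++ m :: s ∧ (∀ a ∈ u, a < m) ∧ ∀ a ∈ s, a < m := by
  obtain ⟨m, hm, hmax⟩ := Finset.exists_max_image w.toFinset id
    (List.toFinset_nonempty_iff w |>.2 hne)
  obtain ⟨u, s, rfl⟩ := List.append_of_mem (List.mem_toFinset.1 hm)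
  rw [List.nodup_middle, List.nodup_cons] at hw
  refine ⟨m, u, s, rfl, fun a ha => ?_, fun a ha => ?_⟩
  · refine lt_of_le_of_ne (hmax a (by simp [ha])) ?_
    rintro rfl
    simp [ha] at hw
  · refine lt_of_le_of_ne (hmax a (by simp [ha])) ?_
    rintro rfl
    simp [ha] at hw

/-- Column strictness of the tableau is bypassed: unless the largest letter is last, the shape is
the fourth corner of a `RowSquare` whose other corners lack the last letter, the largest letter, or
both. If the largest letter is last, it just lengthens row `0`. -/
theorem antitone_wordShape {w : List α} (hw : w.Nodup) : Antitone (wordShape w) := by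
  induction hn : w.length using Nat.strong_induction_on generalizing w with
  | _ n ih =>
    rcases eq_or_ne w [] with rfl | hne
    · exact fun i j _ => le_rfl
    obtain ⟨m, u, s, rfl, hu, hs⟩ := exists_max_split hw hne
    have hnd : (u ++ s).Nodup := (List.nodup_cons.1 (List.nodup_middle.1 hw)).2
    rcases List.eq_nil_or_concat' s with rfl | ⟨s, y, rfl⟩
    · rw [wordShape_concat_max hu]
      have h := ih u.length (by simp [← hn]) (List.Nodup.of_append_left hnd) rfl
      refine antitone_nat_of_succ_le fun i => ?_
      have := h (Nat.le_succ i)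
      simp only [bump]
      grind
    · simp only [List.mem_append, List.mem_singleton] at hs
      refine (rowSquare_wordShape hu (fun a ha => hs a (Or.inl ha)) (hs y (Or.inr rfl))).antitone
        (ih (u ++ s).length ?_ ?_ rfl) (ih _ ?_ hnd rfl) (ih (u ++ m :: s).length ?_ ?_ rfl)
      · simp only [List.length_append, List.length_cons] at hn ⊢
        omega
      · rw [← List.append_assoc] at hnd
        exact List.Nodup.of_append_left hnd
      · simp [← hn]
      · simp [← hn]
      · rw [← List.cons_append, ← List.append_assoc] at hw
        exact List.Nodup.of_append_left hw

/-! ### Removing the first letter -/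

/-- A largest letter that comes first stays in the first column: whenever its box is needed it drops
to the next row, which is empty by monotonicity. -/
theorem wordShape_cons_max {m : α} {w : List α} (hnd : w.Nodup) (hw : ∀ a ∈ w, a < m) :
    ∃ p, wordShape (m :: w) = bump (wordShape w) p ∧ wordShape w p = 0 := by
  induction w using List.reverseRecOn with
  | nil => exact ⟨0, wordShape_concat_max (u := []) (by simp), rfl⟩
  | append_singleton w y ih =>
    simp only [List.mem_append, List.mem_singleton] at hw
    have hnd' := List.Nodup.of_append_left hnd
    obtain ⟨p, hp, hp0⟩ := ih hnd' fun a ha => hw a (Or.inl ha)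
    obtain ⟨b, v, e, h1, h2, h3, h4, h5⟩ := rowSquare_wordShape (u := []) (by simp)
      (fun a ha => hw a (Or.inl ha)) (hw y (Or.inr rfl))
    simp only [List.nil_append] at h1 h2 h3
    obtain rfl := bump_injective _ (hp.symm.trans h2)
    refine ⟨e, h3, ?_⟩
    rw [h1]
    have := antitone_wordShape hnd' (Nat.le_succ p)
    rcases eq_or_ne b p with rfl | hne
    · simp only [Nat.succ_eq_add_one, hp0, Nat.le_zero] at this
      simp [bump, h5 rfl, this]
    · simp [bump, h4 hne, hne.symm, hp0]

theorem JdtSquare.exists_bump {l A l' A' : ℕ → ℕ} (h : JdtSquare l A l' A') :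
    ∃ c, A' = bump l' c := by
  obtain ⟨c, b, d, rfl, rfl, rfl, h1, h2⟩ := h
  rcases eq_or_ne b c with rfl | hne
  · exact ⟨d, rfl⟩
  · exact ⟨c, by rw [h1 hne, bump_comm]⟩

/-- Serves the case in which the last letter is also the largest: it joins the first row whether or
not the word has been given an extra first letter. -/
theorem jdtSquare_and_colSquare_of_bump_zero {l A : ℕ → ℕ} (h : ∃ c, A = bump l c) :
    JdtSquare l A (bump l 0) (bump A 0) ∧ ColSquare l A (bump l 0) (bump A 0) := by
  obtain ⟨c, rfl⟩ := h
  refine ⟨⟨c, 0, 0, rfl, rfl, rfl, fun _ => rfl, fun h => Or.inl h⟩,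
    ⟨c, 0, 0, rfl, rfl, rfl, fun _ => rfl, ?_⟩⟩
  rintro rfl
  simp [bump]

/-- Removing the first letter `x` of a word: the shapes with and without `x` obey the local rule of
jeu de taquin when a last letter is inserted and the local rule of column insertion when a largest
letter is inserted. -/
theorem jdtSquare_and_colSquare_wordShape {x : α} {w : List α} (hw : (x :: w).Nodup) :
    (∀ u y, w = u ++ [y] → JdtSquare (wordShape u) (wordShape (x :: u)) (wordShape w)
      (wordShape (x :: w))) ∧
    ∀ u m s, w = u ++ m :: s → x < m → (∀ a ∈ u, a < m) → (∀ a ∈ s, a < m) →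
      ColSquare (wordShape (u ++ s)) (wordShape (x :: (u ++ s))) (wordShape w)
        (wordShape (x :: w)) := by
  induction hn : w.length using Nat.strong_induction_on generalizing w with
  | _ n ih =>
    have hbump : ∀ u : List α, u.length < n → (x :: u).Nodup →
        ∃ c, wordShape (x :: u) = bump (wordShape u) c := by
      intro u hu hnd
      rcases List.eq_nil_or_concat' u with rfl | ⟨u, y, rfl⟩
      · exact ⟨0, wordShape_concat_max (u := []) (by simp)⟩
      · exact ((ih _ hu hnd rfl).1 u y rfl).exists_bump
    -- Here the largest letter `m` of `x :: w` lies in `w`. If it is not last, the induction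
    -- hypothesis for `w` without `m` gives the jeu de taquin face, the one for `w` without its last
    -- letter gives the column face, and `cube` completes the picture.
    have key : ∀ u m s, w = u ++ m :: s → x < m → (∀ a ∈ u, a < m) → (∀ a ∈ s, a < m) →
        (∀ u y, w = u ++ [y] → JdtSquare (wordShape u) (wordShape (x :: u)) (wordShape w)
          (wordShape (x :: w))) ∧
        ColSquare (wordShape (u ++ s)) (wordShape (x :: (u ++ s))) (wordShape w)
          (wordShape (x :: w)) := by
      rintro u m s rfl hx hu hs
      have hxu : ∀ a ∈ x :: u, a < m := by simpa using ⟨hx, hu⟩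
      have hnd : (x :: (u ++ s)).Nodup := by
        rw [← List.cons_append] at hw ⊢
        exact (List.nodup_cons.1 (List.nodup_middle.1 hw)).2
      rcases List.eq_nil_or_concat' s with rfl | ⟨s, y, rfl⟩
      · rw [List.append_nil] at hnd ⊢
        have := jdtSquare_and_colSquare_of_bump_zero (hbump u (by simp [← hn]) hnd)
        rw [← wordShape_concat_max hu, ← wordShape_concat_max hxu] at this
        refine ⟨fun u' y' h => ?_, this.2⟩
        obtain ⟨rfl, -⟩ := List.append_inj' h rfl
        exact this.1
      · simp only [List.mem_append, List.mem_singleton] at hs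
        have hs' := fun a ha => hs a (Or.inl ha)
        have hy := hs y (Or.inr rfl)
        have h1 : u ++ (s ++ [y]) = (u ++ s) ++ [y] := (List.append_assoc _ _ _).symm
        have h2 : u ++ m :: (s ++ [y]) = (u ++ m :: s) ++ [y] := by simp
        have hnd1 : (x :: (u ++ s)).Nodup := by
          rw [h1, ← List.cons_append] at hnd
          exact List.Nodup.of_append_left hnd
        have hnd2 : (x :: (u ++ m :: s)).Nodup := by
          rw [h2, ← List.cons_append] at hw
          exact List.Nodup.of_append_left hw
        have hJ := (ih (u ++ (s ++ [y])).length (by simp [← hn]) hnd rfl).1 (u ++ s) y h1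
        have hC := (ih (u ++ m :: s).length (by simp [← hn]) hnd2 rfl).2 u m s rfl hx hu hs'
        have := cube (antitone_wordShape (List.nodup_cons.1 hnd).2)
          (antitone_wordShape (List.nodup_cons.1 hnd2).2) (antitone_wordShape hnd1)
          (antitone_wordShape hnd) (antitone_wordShape hnd2) hJ hC
          (rowSquare_wordShape hu hs' hy) (rowSquare_wordShape hxu hs' hy)
        refine ⟨fun u' y' h => ?_, this.2⟩
        rw [h2] at h
        obtain ⟨rfl, -⟩ := List.append_inj' h rfl
        exact this.1
    refine ⟨fun u y h => ?_, fun u m s h1 h2 h3 h4 => (key u m s h1 h2 h3 h4).2⟩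
    obtain ⟨m, u', s, hsplit, hu', hs⟩ := exists_max_split hw (by simp)
    -- An empty prefix means that `x` itself is the largest letter. Its box then lies in the first
    -- column, and when displaced it moves down, rows `p` and `p + 1` of the smaller shape both
    -- being empty.
    rcases u' with _ | ⟨x', u'⟩
    · simp only [List.nil_append, List.cons.injEq] at hsplit
      obtain ⟨rfl, rfl⟩ := hsplit
      subst h
      simp only [List.mem_append, List.mem_singleton] at hs
      have hnd := List.Nodup.of_append_left (List.nodup_cons.1 hw).2
      obtain ⟨p, hp, hp0⟩ := wordShape_cons_max hnd fun a ha => hs a (Or.inl ha)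
      obtain ⟨b, v, e, h1, h2, h3, h4, h5⟩ := rowSquare_wordShape (u := []) (by simp)
        (fun a ha => hs a (Or.inl ha)) (hs y (Or.inr rfl))
      simp only [List.nil_append] at h1 h2 h3
      obtain rfl := bump_injective _ (hp.symm.trans h2)
      refine ⟨p, b, if b = p then p + 1 else b, hp, h1, ?_, fun h => if_neg h, fun h => ?_⟩
      · rw [h3, h1, h2]
        rcases eq_or_ne b p with rfl | hne
        · simp [h5 rfl]
        · rw [if_neg hne, h4 hne, bump_comm]
      · have := antitone_wordShape hnd (Nat.le_succ p)
        exact Or.inr ⟨if_pos h, by simp only [Nat.succ_eq_add_one] at this; omega⟩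
    · simp only [List.cons_append, List.cons.injEq] at hsplit
      obtain ⟨rfl, hsplit⟩ := hsplit
      exact (key u' m s hsplit (hu' x (by simp)) (fun a ha => hu' a (by simp [ha])) hs).1 u y h

end Insertion

/-! ### Young diagrams of words -/

theorem ext_of_mem_iff {μ ν : YoungDiagram} (h : ∀ c, c ∈ μ ↔ c ∈ ν) : μ = ν :=
  YoungDiagram.ext (Finset.ext h)

theorem adds_of_mem_iff {μ ν : YoungDiagram} {m : ℕ × ℕ} (hm : m ∉ μ)
    (h : ∀ c, c ∈ ν ↔ c = m ∨ c ∈ μ) : Adds μ ν := by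
  refine ⟨fun c hc => (h c).2 (Or.inr hc), ?_⟩
  have : ν.cells = insert m μ.cells := by
    ext c
    simp [h]
  rw [YoungDiagram.card, this, Finset.card_insert_of_notMem (by simpa using hm)]

section WordDiagram

variable {α : Type*}

theorem finite_rowLens (T : List (List α)) : {c : ℕ × ℕ | c.2 < rowLens T c.1}.Finite := by
  refine ((Finset.range T.length).sigma fun i => Finset.range (rowLens T i)).finite_toSet.image
    (fun c => (c.1, c.2)) |>.subset ?_
  rintro ⟨i, j⟩ h
  refine ⟨⟨i, j⟩, ?_, rfl⟩
  simp only [Set.mem_ofPred_eq] at h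
  simp only [Finset.coe_sigma, Set.mem_sigma_iff, Finset.coe_range, Set.mem_Iio]
  refine ⟨?_, h⟩
  by_contra hi
  simp [rowLens, List.getElem?_eq_none (not_lt.1 hi)] at h

/-- The first `n` terms of a sequence. -/
def initialWord (x : ℕ → α) (n : ℕ) : List α := (List.range n).map x

theorem initialWord_succ (x : ℕ → α) (n : ℕ) : initialWord x (n + 1) = initialWord x n ++ [x n] := by
  simp [initialWord, List.range_succ]

theorem initialWord_succ_eq_cons (x : ℕ → α) (n : ℕ) :
    initialWord x (n + 1) = x 0 :: initialWord (shift x) n := by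
  simp [initialWord, List.range_succ_eq_map, shift, Function.comp_def]

theorem nodup_initialWord {x : ℕ → α} (hx : Function.Injective x) (n : ℕ) :
    (initialWord x n).Nodup := List.nodup_range.map hx

theorem shift_injective {x : ℕ → α} (hx : Function.Injective x) :
    Function.Injective (shift x) := fun _ _ h => Nat.succ_injective (hx h)

variable [LinearOrder α]

open Classical in
/-- The Young diagram underlying the insertion tableau of a word without repetitions. -/
noncomputable def wordDiagram (w : List α) : YoungDiagram :=
  if h : w.Nodup then
    { cells := (finite_rowLens (insertWord w)).toFinset
      isLowerSet := by
        rintro ⟨i, j⟩ ⟨i', j'⟩ hle hc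
        obtain ⟨hi, hj⟩ := Prod.mk_le_mk.1 hle
        simp only [Set.Finite.coe_toFinset, Set.mem_ofPred_eq] at hc ⊢
        exact hj.trans_lt (hc.trans_le (antitone_wordShape h hi)) }
  -- With this default the path of a sequence collapses to the empty diagram once a term repeats, so
  -- repetitions can be read off from `rskPath`.
  else ⊥

theorem mem_wordDiagram {w : List α} (h : w.Nodup) {c : ℕ × ℕ} :
    c ∈ wordDiagram w ↔ c.2 < wordShape w c.1 := by
  rw [wordDiagram, dif_pos h, ← YoungDiagram.mem_cells]
  simp [wordShape]

theorem wordDiagram_nil : wordDiagram ([] : List α) = ⊥ :=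
  ext_of_mem_iff fun c => by simp [mem_wordDiagram List.nodup_nil, wordShape]

theorem mem_of_wordShape_eq_bump {β : Type*} [LinearOrder β] {w : List α} {w' : List β}
    (hw : w.Nodup) (hw' : w'.Nodup) {b : ℕ} (h : wordShape w' = bump (wordShape w) b)
    (c : ℕ × ℕ) : c ∈ wordDiagram w' ↔ c = (b, wordShape w b) ∨ c ∈ wordDiagram w := by
  obtain ⟨i, j⟩ := c
  rw [mem_wordDiagram hw, mem_wordDiagram hw', h, Prod.mk.injEq]
  simp only [bump]
  by_cases hi : i = b
  · subst hi; simp; omega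
  · simp [hi]

theorem adds_of_wordShape_eq_bump {w w' : List α} (hw : w.Nodup) (hw' : w'.Nodup) {b : ℕ}
    (h : wordShape w' = bump (wordShape w) b) : Adds (wordDiagram w) (wordDiagram w') :=
  adds_of_mem_iff (m := (b, wordShape w b)) (by rw [mem_wordDiagram hw]; simp)
    (mem_of_wordShape_eq_bump hw hw' h)

theorem exists_rowLens_insertStep (y : α) (T : List (List α)) :
    ∃ b, rowLens (insertStep y T) = bump (rowLens T) b := by
  induction T generalizing y with
  | nil =>
    refine ⟨0, funext fun i => ?_⟩
    cases i <;> simp [insertStep, bump]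
  | cons r T ih =>
    rcases hz : (rowInsert y r).2 with _ | z
    · refine ⟨0, funext fun i => ?_⟩
      rw [insertStep_cons_of_none hz]
      cases i <;> simp [bump]
    · obtain ⟨s, t, h1, h2, -, -⟩ := rowInsert_some hz
      obtain ⟨b, hb⟩ := ih z
      refine ⟨b + 1, funext fun i => ?_⟩
      rw [insertStep_cons_of_some hz, h2]
      cases i with
      | zero => simp [bump, h1]
      | succ i => simp [hb, bump]

theorem exists_wordShape_concat (w : List α) (y : α) :
    ∃ b, wordShape (w ++ [y]) = bump (wordShape w) b := by
  rw [wordShape, insertWord_concat]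
  exact exists_rowLens_insertStep y _

theorem card_wordDiagram {w : List α} (hw : w.Nodup) : (wordDiagram w).card = w.length := by
  induction w using List.reverseRecOn with
  | nil => simp [wordDiagram_nil]
  | append_singleton w y ih =>
    have hw' := List.Nodup.of_append_left hw
    obtain ⟨b, hb⟩ := exists_wordShape_concat w y
    rw [(adds_of_wordShape_eq_bump hw' hw hb).2, ih hw', List.length_append, List.length_singleton]

theorem mem_rskShape {x : ℕ → α} {n : ℕ} {c : ℕ × ℕ} :
    c ∈ rskShape x n ↔ c.2 < wordShape (initialWord x n) c.1 := by
  rw [rskShape, insertionTableau_eq]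
  rfl

/-- The path in the Young graph traced by the RSK shapes of a sequence. -/
noncomputable def rskPath (x : ℕ → α) (n : ℕ) : YoungDiagram := wordDiagram (initialWord x n)

theorem mem_rskPath {x : ℕ → α} (hx : Function.Injective x) {n : ℕ} {c : ℕ × ℕ} :
    c ∈ rskPath x n ↔ c ∈ rskShape x n := by
  rw [rskPath, mem_wordDiagram (nodup_initialWord hx n), mem_rskShape]

theorem rskPath_zero (x : ℕ → α) : rskPath x 0 = ⊥ := wordDiagram_nil

theorem adds_rskPath {x : ℕ → α} (hx : Function.Injective x) (n : ℕ) :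
    Adds (rskPath x n) (rskPath x (n + 1)) := by
  obtain ⟨b, hb⟩ := exists_wordShape_concat (initialWord x n) (x n)
  rw [← initialWord_succ] at hb
  exact adds_of_wordShape_eq_bump (nodup_initialWord hx n) (nodup_initialWord hx _) hb

end WordDiagram

/-! ### Paths in the Young graph and infinite tableaux -/

/-- A path in the Young graph that starts at the empty diagram and eventually contains every box
is the path of an infinite tableau. -/
theorem exists_infiniteTableau {p : ℕ → YoungDiagram} (h0 : p 0 = ⊥)
    (h1 : ∀ n, Adds (p n) (p (n + 1))) (h2 : ∀ c, ∃ n, c ∈ p n) :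
    ∃ t : InfiniteTableau, ∀ n c, t.entry c ≤ n ↔ c ∈ p n := by
  classical
  have hmono : Monotone p := monotone_nat_of_le_succ fun n => (h1 n).1
  have hle : ∀ n c, Nat.find (h2 c) ≤ n ↔ c ∈ p n := fun n c =>
    ⟨fun h => hmono h (Nat.find_spec (h2 c)), fun h => Nat.find_min' _ h⟩
  have hpos : ∀ c, 1 ≤ Nat.find (h2 c) := fun c => by
    by_contra h
    have := (hle 0 c).1 (by omega)
    rw [h0] at this
    exact YoungDiagram.notMem_bot c this
  have hinj : ∀ n c d, c ∈ p (n + 1) → d ∈ p (n + 1) → c ∉ p n → d ∉ p n → c = d := by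
    intro n c d hc hd hc' hd'
    obtain ⟨m, -, hm⟩ := exists_eq_insert (h1 n)
    have e1 := ((hm c).1 hc).resolve_right hc'
    have e2 := ((hm d).1 hd).resolve_right hd'
    rw [e1, e2]
  -- The first diagram containing `d` also contains `c`, being a lower set, and only one of the two
  -- boxes can be new in it.
  have hlt : ∀ c d, c ≤ d → c ≠ d → Nat.find (h2 c) < Nat.find (h2 d) := by
    intro c d hcd hne
    obtain ⟨n, hn⟩ : ∃ n, Nat.find (h2 d) = n + 1 := ⟨_, (Nat.sub_add_cancel (hpos d)).symm⟩
    rw [hn, Nat.lt_succ_iff, hle]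
    by_contra hc
    have hd : d ∈ p (n + 1) := (hle _ _).1 hn.le
    refine hne (hinj n c d ((p (n + 1)).isLowerSet hcd hd) hd hc fun h => ?_)
    have := (hle n d).2 h
    omega
  refine ⟨⟨fun c => Nat.find (h2 c), ⟨fun c _ => hpos c, fun c _ d _ h => ?_, fun n hn => ?_⟩,
    fun i j => hlt _ _ ?_ (by simp), fun i j => hlt _ _ ?_ (by simp)⟩, hle⟩
  · obtain ⟨n, hn⟩ : ∃ n, Nat.find (h2 d) = n + 1 := ⟨_, (Nat.sub_add_cancel (hpos d)).symm⟩
    simp only at h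
    refine hinj n c d ((hle _ _).1 (by omega)) ((hle _ _).1 hn.le) ?_ ?_ <;>
    · rw [← hle]; omega
  · obtain ⟨k, rfl⟩ : ∃ k, n = k + 1 := ⟨_, (Nat.sub_add_cancel hn).symm⟩
    obtain ⟨m, hm, hm'⟩ := exists_eq_insert (h1 k)
    refine ⟨m, trivial, le_antisymm ((hle _ _).2 ((hm' m).2 (Or.inl rfl))) ?_⟩
    rw [← hle] at hm
    simp only
    omega
  · exact ⟨le_rfl, Nat.le_succ j⟩
  · exact ⟨Nat.le_succ i, le_rfl⟩

theorem InfiniteTableau.mem_shape (t : InfiniteTableau) {n : ℕ} {c : ℕ × ℕ} :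
    c ∈ t.shape n ↔ t.entry c ≤ n := by
  rw [← YoungDiagram.mem_cells]
  simp [InfiniteTableau.shape]

theorem InfiniteTableau.ext_of_le_iff {t t' : InfiniteTableau}
    (h : ∀ n c, t.entry c ≤ n ↔ t'.entry c ≤ n) : t = t' := by
  ext c
  exact le_antisymm ((h _ c).2 le_rfl) ((h _ c).1 le_rfl)

/-! ### Recording tableaux and the shift -/

section Recording

variable {α : Type*} [LinearOrder α]

theorem mem_rskDomain_iff {x : ℕ → α} :
    x ∈ rskDomain ↔ Function.Injective x ∧ ∀ c, ∃ n, c ∈ rskShape x n := by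
  refine ⟨fun ⟨hx, t, ht⟩ => ⟨hx, fun c => ⟨_, (ht _ c).1 le_rfl⟩⟩, fun ⟨hx, h⟩ => ⟨hx, ?_⟩⟩
  obtain ⟨t, ht⟩ := exists_infiniteTableau (rskPath_zero x) (adds_rskPath hx)
    fun c => (h c).imp fun n hn => (mem_rskPath hx).2 hn
  exact ⟨t, fun n c => (ht n c).trans (mem_rskPath hx)⟩

theorem isRecordingTableau_rsk {x : ℕ → α} (hx : x ∈ rskDomain) :
    IsRecordingTableau x (rsk x) := by
  rw [rsk, dif_pos hx]
  exact hx.2.choose_spec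

theorem shapePath_rsk {x : ℕ → α} (hx : x ∈ rskDomain) : (rsk x).shapePath = rskPath x := by
  funext n
  refine ext_of_mem_iff fun c => ?_
  rw [mem_rskPath hx.1, ← isRecordingTableau_rsk hx]
  exact (rsk x).mem_shape

theorem jdtSquare_initialWord {x : ℕ → α} (hx : Function.Injective x) (n : ℕ) :
    JdtSquare (wordShape (initialWord (shift x) n)) (wordShape (initialWord x (n + 1)))
      (wordShape (initialWord (shift x) (n + 1))) (wordShape (initialWord x (n + 2))) := by
  have hnd := nodup_initialWord hx (n + 2)
  rw [initialWord_succ_eq_cons] at hnd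
  have := (jdtSquare_and_colSquare_wordShape hnd).1 _ _ (initialWord_succ (shift x) n)
  rwa [← initialWord_succ_eq_cons, ← initialWord_succ_eq_cons] at this

/-- The shapes of `x` and of `shift x` differ in the last box of the jeu de taquin path of the
recording tableau. -/
theorem exists_jdtPath_eq {x : ℕ → α} (hx : Function.Injective x) {t : InfiniteTableau}
    (ht : IsRecordingTableau x t) (n : ℕ) :
    ∃ k c, wordShape (initialWord x (n + 1)) = bump (wordShape (initialWord (shift x) n)) c ∧
      t.jdtPath k = (c, wordShape (initialWord (shift x) n) c) ∧
      n + 1 < t.entry (t.jdtPath (k + 1)) := by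
  have hmem : ∀ m c, t.entry c ≤ m ↔ c.2 < wordShape (initialWord x m) c.1 := fun m c =>
    (ht m c).trans mem_rskShape
  induction n with
  | zero =>
    refine ⟨0, 0, ?_, rfl, ?_⟩
    · exact wordShape_concat_max (u := []) (by simp)
    · have := t.entry_jdtPath_lt 0
      have := t.one_le (t.jdtPath 0)
      omega
  | succ n ih =>
    obtain ⟨k, c, h1, h2, h3⟩ := ih
    obtain ⟨c', b, d, hc, hl', hA', hb1, hb2⟩ := jdtSquare_initialWord hx n
    obtain rfl := bump_injective _ (h1.symm.trans hc)
    have anti₀ := antitone_wordShape (nodup_initialWord (shift_injective hx) n)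
    have anti := antitone_wordShape (nodup_initialWord (shift_injective hx) (n + 1))
    rw [hc] at hA'
    have hm1 := hmem (n + 1)
    have hm2 := hmem (n + 2)
    rw [hc] at hm1
    rw [hA'] at hm2
    rw [hA']
    rw [hl'] at anti ⊢
    generalize wordShape (initialWord (shift x) n) = l at *
    have step : t.jdtPath (k + 1) =
        if t.entry (c + 1, l c) < t.entry (c, l c + 1) then (c + 1, l c) else (c, l c + 1) := by
      rw [InfiniteTableau.jdtPath, h2]
    -- The path advances exactly when the shifted shape takes over the current difference box, that
    -- is when `b = c`. Otherwise the difference box and `k` stay the same.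
    rcases eq_or_ne b c with rfl | hne
    · have hq : t.jdtPath (k + 1) = (d, bump l b d) := by
        -- Exactly one of the two candidate boxes belongs to the shape of the first `n + 2` terms.
        -- It therefore has the smaller entry, and the path steps to it.
        rcases hb2 rfl with rfl | ⟨rfl, hcol⟩
        · have e1 := (hm2 (d, l d + 1)).2 (by simp [bump])
          have e2 : ¬ t.entry (d + 1, l d) ≤ n + 2 := by
            rw [hm2]
            simpa [bump] using anti₀ (Nat.le_succ d)
          rw [step, if_neg (by omega)]
          simp [bump]
        · have e1 := (hm2 (b + 1, l b)).2 (by simp [bump, hcol])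
          have e2 : ¬ t.entry (b, l b + 1) ≤ n + 2 := by
            rw [hm2]
            simp [bump]
          rw [step, if_pos (by omega)]
          simp [bump, hcol]
      refine ⟨k + 1, d, rfl, hq, ?_⟩
      rw [← not_le, hm2, InfiniteTableau.jdtPath, hq]
      have := anti (Nat.le_succ d)
      split_ifs
      · simp only [bump] at this ⊢
        grind
      · simp [bump]
    · obtain rfl := hb1 hne
      refine ⟨k, c, bump_comm _ _ _, ?_, ?_⟩
      · rw [h2]
        simp [bump, hne.symm]
      · rw [← not_le, hm2, step]
        have := anti (Nat.le_succ c)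
        split_ifs <;> (simp [bump] at this ⊢; grind)

/-- Jeu de taquin of the recording tableau corresponds to the shift of the sequence. -/
theorem isRecordingTableau_shift {x : ℕ → α} (hx : Function.Injective x) {t : InfiniteTableau}
    (ht : IsRecordingTableau x t) : IsRecordingTableau (shift x) t.jdt := by
  intro n c
  obtain ⟨k, r, h1, h2, h3⟩ := exists_jdtPath_eq hx ht n
  have hmem : ∀ c, t.entry c ≤ n + 1 ↔ c = t.jdtPath k ∨ c ∈ rskShape (shift x) n := by
    intro c
    rw [ht, mem_rskShape, ← mem_wordDiagram (nodup_initialWord hx _), h2,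
      mem_of_wordShape_eq_bump (nodup_initialWord (shift_injective hx) n)
      (nodup_initialWord hx _) h1, mem_wordDiagram (nodup_initialWord (shift_injective hx) n),
      mem_rskShape]
  have hk : t.jdtPath k ∉ rskShape (shift x) n := by
    rw [mem_rskShape, h2]
    exact lt_irrefl _
  have hmono : StrictMono fun j => t.entry (t.jdtPath j) :=
    strictMono_nat_of_lt_succ t.entry_jdtPath_lt
  -- Entries increase along the path, so its boxes with entry at most `n + 1` are those of index at
  -- most `k`. Pulling entries back by one box then loses exactly the box of index `k`, the
  -- difference of the two shapes.
  have hpath : ∀ j, t.entry (t.jdtPath j) ≤ n + 1 ↔ j ≤ k := by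
    intro j
    constructor
    · intro h
      by_contra hj
      have := hmono.monotone (show k + 1 ≤ j by omega)
      omega
    · intro h
      exact (hmono.monotone h).trans ((hmem _).2 (Or.inl rfl))
  change t.jdtEntry c ≤ n ↔ _
  by_cases hc : ∃ j, t.jdtPath j = c
  · obtain ⟨j, rfl⟩ := hc
    rw [t.jdtEntry_path, Nat.sub_le_iff_le_add, hpath]
    have h5 := (hpath j).symm.trans (hmem _)
    rw [t.jdtPath_injective.eq_iff] at h5
    constructor
    · intro h
      exact (h5.1 (by omega)).resolve_left (by omega)
    · intro h
      have : j ≠ k := by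
        rintro rfl
        exact hk h
      have := h5.2 (Or.inr h)
      omega
  · push Not at hc
    rw [t.jdtEntry_off hc, Nat.sub_le_iff_le_add, hmem, or_iff_right fun h => hc k h.symm]

theorem jdt_rsk {x : ℕ → α} (hx : x ∈ rskDomain) :
    shift x ∈ rskDomain ∧ (rsk x).jdt = rsk (shift x) := by
  have h := isRecordingTableau_shift hx.1 (isRecordingTableau_rsk hx)
  have hs : shift x ∈ rskDomain := ⟨shift_injective hx.1, _, h⟩
  refine ⟨hs, InfiniteTableau.ext_of_le_iff fun n c => ?_⟩
  rw [h, isRecordingTableau_rsk hs]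

/-- Used to compare the event that a given box is ever filled with its preimage under `shift`. -/
theorem rskShape_shift_subset {x : ℕ → α} (hx : Function.Injective x) (n : ℕ) :
    rskShape (shift x) n ⊆ rskShape x (n + 1) := by
  intro c hc
  obtain ⟨r, -, -, h, -⟩ := jdtSquare_initialWord hx n
  rw [mem_rskShape] at hc ⊢
  rw [h]
  exact hc.trans_le (Nat.le_add_right _ _)

end Recording

/-! ### Counting words with a given sequence of shapes -/

section Counting

variable {α : Type*} [LinearOrder α]

/-- The rows are nonempty and weakly increasing. -/
def SortedRows (T : List (List α)) : Prop := ∀ r ∈ T, r ≠ [] ∧ r.Pairwise (· ≤ ·)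

theorem le_of_rowInsert_some {y z : α} {r : List α} (hr : r.Pairwise (· ≤ ·))
    (h : (rowInsert y r).2 = some z) :
    ∃ s t, r = s ++ z :: t ∧ (rowInsert y r).1 = s ++ y :: t ∧ y < z ∧ (∀ a ∈ s, a ≤ y) ∧
      ∀ a ∈ t, z ≤ a := by
  obtain ⟨s, t, h1, h2, h3, h4⟩ := rowInsert_some h
  refine ⟨s, t, h1, h2, h3, h4, ?_⟩
  rw [h1, List.pairwise_append, List.pairwise_cons] at hr
  exact hr.2.1.1

theorem sortedRows_insertStep {y : α} {T : List (List α)} (h : SortedRows T) :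
    SortedRows (insertStep y T) := by
  induction T generalizing y with
  | nil => simp [insertStep, SortedRows]
  | cons r T ih =>
    simp only [SortedRows, List.mem_cons, forall_eq_or_imp] at h
    rcases hz : (rowInsert y r).2 with _ | z
    · rw [insertStep_cons_of_none hz]
      have hle : ∀ a ∈ r, a ≤ y := by
        have := h.1.2
        clear h ih
        induction r with
        | nil => simp
        | cons a r ihr =>
          rw [rowInsert] at hz
          split_ifs at hz with hlt
          simp only [List.mem_cons, forall_eq_or_imp]
          exact ⟨not_lt.1 hlt, ihr hz this.of_cons⟩
      simp only [SortedRows, List.mem_cons, forall_eq_or_imp]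
      refine ⟨⟨by simp, ?_⟩, h.2⟩
      rw [List.pairwise_append]
      exact ⟨h.1.2, by simp, by simpa using hle⟩
    · obtain ⟨s, t, h1, h2, h3, h4, h5⟩ := le_of_rowInsert_some h.1.2 hz
      rw [insertStep_cons_of_some hz, h2]
      simp only [SortedRows, List.mem_cons, forall_eq_or_imp]
      refine ⟨⟨by simp, ?_⟩, ih h.2⟩
      have := h.1.2
      rw [h1, List.pairwise_append, List.pairwise_cons] at this
      rw [List.pairwise_append, List.pairwise_cons]
      refine ⟨this.1, ⟨fun a ha => h3.le.trans (h5 a ha), this.2.1.2⟩, fun a ha b hb => ?_⟩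
      rcases List.mem_cons.1 hb with rfl | hb
      · exact h4 a ha
      · exact this.2.2 a ha b (by simp [hb])

theorem sortedRows_insertWord (w : List α) : SortedRows (insertWord w) := by
  induction w using List.reverseRecOn with
  | nil => simp [SortedRows]
  | append_singleton w y ih =>
    rw [insertWord_concat]
    exact sortedRows_insertStep ih

/-- In a sorted row the bumped letter `z` tells where the change took place: the entries of the new
row below `z` form an initial segment whose last element is the inserted letter. -/
theorem rowInsert_injective {y y' z : α} {r r' : List α} (hr : r.Pairwise (· ≤ ·))
    (hr' : r'.Pairwise (· ≤ ·)) (hz : (rowInsert y r).2 = some z)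
    (hz' : (rowInsert y' r').2 = some z) (h : (rowInsert y r).1 = (rowInsert y' r').1) :
    y = y' ∧ r = r' := by
  obtain ⟨s, t, rfl, h2, h3, h4, h5⟩ := le_of_rowInsert_some hr hz
  obtain ⟨s', t', rfl, h2', h3', h4', h5'⟩ := le_of_rowInsert_some hr' hz'
  rw [h2, h2'] at h
  have hfilter : ∀ (s t : List α) (y : α), y < z → (∀ a ∈ s, a ≤ y) → (∀ a ∈ t, z ≤ a) →
      (s ++ y :: t).filter (· < z) = s ++ [y] := by
    intro s t y h3 h4 h5
    rw [List.filter_append, List.filter_cons_of_pos (by simpa using h3),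
      List.filter_eq_self.2 (fun a ha => by simpa using (h4 a ha).trans_lt h3),
      List.filter_eq_nil_iff.2 (fun a ha => by simpa using h5 a ha)]
  have h6 := hfilter s t y h3 h4 h5
  rw [h, hfilter s' t' y' h3' h4' h5'] at h6
  obtain ⟨rfl, h7⟩ := List.append_inj' h6 rfl
  obtain rfl : y' = y := by simpa using h7
  simp_all

/-- The inserted letter and the previous tableau can be recovered from the new tableau and the
previous shape. -/
theorem insertStep_injective {y y' : α} {T T' : List (List α)} (hT : SortedRows T)
    (hT' : SortedRows T') (hl : rowLens T = rowLens T') (h : insertStep y T = insertStep y' T') :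
    y = y' ∧ T = T' := by
  induction T generalizing T' y y' with
  | nil =>
    cases T' with
    | nil => simpa [insertStep] using h
    | cons r' T' =>
      exact absurd (List.length_eq_zero_iff.1 (congrFun hl 0).symm) (hT' r' (by simp)).1
  | cons r T ih =>
    cases T' with
    | nil =>
      exact absurd (List.length_eq_zero_iff.1 (congrFun hl 0)) (hT r (by simp)).1
    | cons r' T' =>
      have h0 : r.length = r'.length := congrFun hl 0
      have hl' : rowLens T = rowLens T' := funext fun i => congrFun hl (i + 1)
      simp only [SortedRows, List.mem_cons, forall_eq_or_imp] at hT hT'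
      -- The old first rows have equal length, so the mixed cases would yield new first rows of
      -- different lengths. If both letters bump, induction on the lower rows recovers the bumped
      -- letter first.
      rcases hz : (rowInsert y r).2 with _ | z <;> rcases hz' : (rowInsert y' r').2 with _ | z'
      · rw [insertStep_cons_of_none hz, insertStep_cons_of_none hz', List.cons.injEq] at h
        obtain ⟨rfl, h2⟩ := List.append_inj h.1 h0
        simp_all
      · obtain ⟨s, t, h1, h2, -⟩ := rowInsert_some hz'
        rw [insertStep_cons_of_none hz, insertStep_cons_of_some hz', List.cons.injEq, h2] at h
        have := congrArg List.length h.1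
        rw [h1] at h0
        simp at h0 this
        omega
      · obtain ⟨s, t, h1, h2, -⟩ := rowInsert_some hz
        rw [insertStep_cons_of_none hz', insertStep_cons_of_some hz, List.cons.injEq, h2] at h
        have := congrArg List.length h.1
        rw [h1] at h0
        simp at h0 this
        omega
      · rw [insertStep_cons_of_some hz, insertStep_cons_of_some hz', List.cons.injEq] at h
        obtain ⟨rfl, rfl⟩ := ih hT.2 hT'.2 hl' h.2
        obtain ⟨rfl, rfl⟩ := rowInsert_injective hT.1.2 hT'.1.2 hz hz' h.1
        exact ⟨rfl, rfl⟩

/-- A word is determined by its insertion tableau and the shapes of its initial segments. -/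
theorem eq_of_insertWord_eq {w w' : List α} (hlen : w.length = w'.length)
    (hshape : ∀ k, wordShape (w.take k) = wordShape (w'.take k))
    (h : insertWord w = insertWord w') : w = w' := by
  induction w using List.reverseRecOn generalizing w' with
  | nil => simpa [eq_comm] using hlen
  | append_singleton w y ih =>
    rcases List.eq_nil_or_concat' w' with rfl | ⟨w', y', rfl⟩
    · simp at hlen
    · have hlen' : w.length = w'.length := by simpa using hlen
      rw [insertWord_concat, insertWord_concat] at h
      have h0 := hshape w.length
      rw [List.take_left, hlen', List.take_left] at h0
      obtain ⟨rfl, h2⟩ := insertStep_injective (sortedRows_insertWord w)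
        (sortedRows_insertWord w') h0 h
      rw [ih hlen' (fun k => ?_) h2]
      rcases le_total k w.length with hk | hk
      · have := hshape k
        rwa [List.take_append_of_le_length hk, List.take_append_of_le_length (hlen' ▸ hk)] at this
      · rw [List.take_of_length_le hk, List.take_of_length_le (hlen' ▸ hk), h0]

/-- The entries of a tableau given as the list of its rows. -/
def tableauEntry (T : List (List ℕ)) (c : ℕ × ℕ) : ℕ := (T.getD c.1 []).getD c.2 0

theorem tableauEntry_addAt (m p : ℕ) (T : List (List ℕ)) (c : ℕ × ℕ) :
    tableauEntry (addAt m p T) c = if c = (p, rowLens T p) then m else tableauEntry T c := by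
  obtain ⟨i, j⟩ := c
  induction p generalizing T i with
  | zero =>
    rcases T with _ | ⟨r, T⟩ <;> rcases i with _ | i
    · rcases j with _ | j <;> simp [tableauEntry, addAt]
    · simp [tableauEntry, addAt]
    · simp only [tableauEntry, addAt, List.getD_cons_zero, Prod.mk.injEq, true_and,
        rowLens_cons_zero]
      rcases lt_trichotomy j r.length with hj | rfl | hj
      · rw [if_neg hj.ne, List.getD_append _ _ _ _ hj]
      · simp
      · rw [if_neg hj.ne', List.getD_eq_default _ _ (by simpa using hj),
          List.getD_eq_default _ _ hj.le]
    · simp [tableauEntry, addAt]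
  | succ p ih =>
    rcases T with _ | ⟨r, T⟩ <;> rcases i with _ | i
    · simp [tableauEntry, addAt]
    · have := ih [] i
      simp only [tableauEntry, addAt, List.getD_cons_succ] at this ⊢
      rw [this]
      simp
    · simp [tableauEntry, addAt]
    · have := ih T i
      simp only [tableauEntry, addAt, List.getD_cons_succ] at this ⊢
      rw [this]
      simp

/-- The insertion tableau of a permutation of `1, …, n` is standard. -/
theorem isStandardTableau_insertWord {n : ℕ} {w : List ℕ}
    (hw : w.Perm ((List.range n).map (· + 1))) :
    IsStandardTableau (wordDiagram w) (tableauEntry (insertWord w)) := by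
  induction n generalizing w with
  | zero =>
    obtain rfl : w = [] := by simpa using hw
    rw [wordDiagram_nil]
    constructor <;> simp [tableauEntry, YoungDiagram.card, Set.BijOn, Set.MapsTo, Set.SurjOn,
      Set.InjOn]
  | succ n ih =>
    have hmem : n + 1 ∈ w := hw.mem_iff.2 (by simp)
    have hnd : w.Nodup := hw.nodup_iff.2 (List.nodup_range.map (add_left_injective 1))
    -- Without the letter `n + 1` the tableau is standard by induction, and that letter contributes
    -- one further box with the largest entry.
    obtain ⟨u, s, rfl⟩ := List.append_of_mem hmem
    have hw0 : (u ++ s).Perm ((List.range n).map (· + 1)) := by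
      rw [List.range_succ, List.map_append, List.map_singleton] at hw
      have := (List.perm_middle.symm.trans hw).trans (List.perm_append_singleton _ _)
      exact this.cons_inv
    have hlt : ∀ a ∈ u ++ s, a < n + 1 := by
      intro a ha
      have := hw0.mem_iff.1 ha
      simp only [List.mem_map, List.mem_range] at this
      omega
    have hnd0 : (u ++ s).Nodup := (List.nodup_cons.1 (List.nodup_middle.1 hnd)).2
    obtain ⟨p, hp⟩ := exists_insertWord_eq_addAt (m := n + 1) (u := u) (s := s)
      (fun a ha => hlt a (by simp [ha])) (fun a ha => hlt a (by simp [ha]))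
    have hb : wordShape (u ++ (n + 1) :: s) = bump (wordShape (u ++ s)) p := by
      rw [wordShape, hp, rowLens_addAt, wordShape]
    have hadd := adds_of_wordShape_eq_bump hnd0 hnd hb
    convert isStandardTableau_extend hadd (ih hw0) using 1
    funext c
    rw [hp, tableauEntry_addAt, card_wordDiagram hnd]
    simp only [mem_of_wordShape_eq_bump hnd0 hnd hb]
    have hlen : (u ++ (n + 1) :: s).length = n + 1 := by simpa using hw.length_eq
    rw [hlen, show rowLens (insertWord (u ++ s)) p = wordShape (u ++ s) p from rfl]
    have hnot : (p, wordShape (u ++ s) p) ∉ wordDiagram (u ++ s) := by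
      rw [mem_wordDiagram hnd0]; exact lt_irrefl _
    by_cases hc : c = (p, wordShape (u ++ s) p)
    · subst hc
      simp [hnot]
    · rw [if_neg hc, if_neg]
      rintro ⟨h1 | h1, h2⟩
      · exact hc h1
      · exact h2 h1

theorem eq_of_getD_eq {β : Type*} {d : β} {r r' : List β} (hl : r.length = r'.length)
    (h : ∀ j, r.getD j d = r'.getD j d) : r = r' :=
  List.ext_getElem hl fun j h1 h2 => by
    have := h j
    rwa [List.getD_eq_getElem _ _ h1, List.getD_eq_getElem _ _ h2] at this

/-- Row lengths and entries do not see trailing empty rows. `SortedRows` excludes these, which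
settles the number of rows. -/
theorem eq_of_tableauEntry_eq {T T' : List (List ℕ)} (hT : SortedRows T) (hT' : SortedRows T')
    (hl : rowLens T = rowLens T') (h : tableauEntry T = tableauEntry T') : T = T' := by
  have hrow : ∀ i, T.getD i [] = T'.getD i [] := fun i =>
    eq_of_getD_eq (congrFun hl i) fun j => congrFun h (i, j)
  have hlen : ∀ {T : List (List ℕ)}, SortedRows T → ∀ i, i < T.length ↔ T.getD i [] ≠ [] := by
    intro T hT i
    constructor
    · intro hi
      rw [List.getD_eq_getElem _ _ hi]
      exact (hT _ (List.getElem_mem hi)).1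
    · intro hi
      by_contra hc
      exact hi (List.getD_eq_default _ _ (not_lt.1 hc))
  refine eq_of_getD_eq (le_antisymm ?_ ?_) hrow
  · by_contra hc
    have := (hlen hT _).1 (not_le.1 hc)
    rw [hrow, ← hlen hT'] at this
    exact lt_irrefl _ this
  · by_contra hc
    have := (hlen hT' _).1 (not_le.1 hc)
    rw [← hrow, ← hlen hT] at this
    exact lt_irrefl _ this

/-- A permutation as a word, with values in `1, …, n`. -/
def permWord {n : ℕ} (σ : Equiv.Perm (Fin n)) : List ℕ := List.ofFn fun i => (σ i : ℕ) + 1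

theorem permWord_perm {n : ℕ} (σ : Equiv.Perm (Fin n)) :
    (permWord σ).Perm ((List.range n).map (· + 1)) := by
  have h1 : permWord σ = (List.ofFn σ).map (fun i : Fin n => (i : ℕ) + 1) := by
    rw [permWord, List.map_ofFn]; rfl
  have h2 : (List.range n).map (· + 1) =
      (List.ofFn (id : Fin n → Fin n)).map (fun i : Fin n => (i : ℕ) + 1) := by
    rw [List.map_ofFn]
    refine List.ext_getElem (by simp) fun i h1 h2 => by simp
  rw [h1, h2]
  exact (Equiv.Perm.ofFn_comp_perm σ id).map _

theorem nodup_permWord {n : ℕ} (σ : Equiv.Perm (Fin n)) : (permWord σ).Nodup :=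
  (permWord_perm σ).nodup_iff.2 (List.nodup_range.map (add_left_injective 1))

theorem permWord_injective {n : ℕ} : Function.Injective (permWord (n := n)) := by
  intro σ τ h
  refine Equiv.ext fun i => Fin.ext ?_
  simpa using congrFun (List.ofFn_injective h) i

theorem wordShape_eq_of_wordDiagram_eq {w w' : List α} (hw : w.Nodup) (hw' : w'.Nodup)
    (h : wordDiagram w = wordDiagram w') : wordShape w = wordShape w' := by
  funext i
  have : ∀ j, j < wordShape w i ↔ j < wordShape w' i := fun j => by
    rw [← mem_wordDiagram hw (c := (i, j)), h, mem_wordDiagram hw']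
  exact le_antisymm (not_lt.1 fun h' => lt_irrefl _ ((this _).1 h'))
    (not_lt.1 fun h' => lt_irrefl _ ((this _).2 h'))

open Classical in
/-- At most `f^μ` permutations have a given sequence of RSK shapes ending in `μ`. -/
theorem card_perm_le_numSYT (n : ℕ) (p : ℕ → YoungDiagram) :
    (Finset.univ.filter fun σ : Equiv.Perm (Fin n) =>
      ∀ k ≤ n, wordDiagram ((permWord σ).take k) = p k).card ≤ numSYT (p n) := by
  have hlen : ∀ σ : Equiv.Perm (Fin n), (permWord σ).length = n := fun σ => by simp [permWord]
  have := finite_standardTableau (p n)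
  rw [numSYT, ← Fintype.card_coe, ← Nat.card_eq_fintype_card]
  have hn : ∀ σ : {σ // σ ∈ Finset.univ.filter fun σ : Equiv.Perm (Fin n) =>
      ∀ k ≤ n, wordDiagram ((permWord σ).take k) = p k}, wordDiagram (permWord σ.1) = p n := by
    intro σ
    have := (Finset.mem_filter.1 σ.2).2 n le_rfl
    rwa [List.take_of_length_le (hlen σ.1).le] at this
  -- The shapes of the prefixes are prescribed, so the insertion tableau alone determines the
  -- permutation.
  refine Nat.card_le_card_of_injective (fun σ => ⟨tableauEntry (insertWord (permWord σ.1)),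
    hn σ ▸ isStandardTableau_insertWord (permWord_perm σ.1)⟩) fun σ τ h => ?_
  have hshape : ∀ k, wordShape ((permWord σ.1).take k) = wordShape ((permWord τ.1).take k) := by
    have aux : ∀ k ≤ n, wordShape ((permWord σ.1).take k) = wordShape ((permWord τ.1).take k) :=
      fun k hk => wordShape_eq_of_wordDiagram_eq (nodup_permWord σ.1).take (nodup_permWord τ.1).take
        (((Finset.mem_filter.1 σ.2).2 k hk).trans ((Finset.mem_filter.1 τ.2).2 k hk).symm)
    intro k
    rcases le_total k n with hk | hk
    · exact aux k hk
    · have := aux n le_rfl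
      rw [List.take_of_length_le (hlen _).le, List.take_of_length_le (hlen _).le] at this
      rwa [List.take_of_length_le ((hlen _).trans_le hk),
        List.take_of_length_le ((hlen _).trans_le hk)]
  have hlast := hshape n
  rw [List.take_of_length_le (hlen _).le, List.take_of_length_le (hlen _).le] at hlast
  refine Subtype.ext (permWord_injective (eq_of_insertWord_eq ((hlen _).trans (hlen _).symm)
    hshape (eq_of_tableauEntry_eq (sortedRows_insertWord _) (sortedRows_insertWord _) hlast
      (congrArg Subtype.val h))))

end Counting

/-! ### The law of the RSK shapes of an i.i.d. sequence -/

section StrictMonoMap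

variable {α β : Type*} [LinearOrder α] [LinearOrder β] {φ : α → β}

/-- Insertion only compares letters. This is what reduces sequences of reals to permutations. -/
theorem rowInsert_map (hφ : StrictMono φ) (y : α) (r : List α) :
    rowInsert (φ y) (r.map φ) = ((rowInsert y r).1.map φ, (rowInsert y r).2.map φ) := by
  induction r with
  | nil => rfl
  | cons a r ih =>
    simp only [List.map_cons, rowInsert, hφ.lt_iff_lt, ih]
    split_ifs <;> rfl

theorem insertStep_map (hφ : StrictMono φ) (y : α) (T : List (List α)) :
    insertStep (φ y) (T.map (List.map φ)) = (insertStep y T).map (List.map φ) := by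
  induction T generalizing y with
  | nil => rfl
  | cons r T ih =>
    rw [List.map_cons]
    have := rowInsert_map hφ y r
    rcases hz : (rowInsert y r).2 with _ | z
    · rw [insertStep_cons_of_none hz, insertStep_cons_of_none (by simp [this, hz])]
      simp
    · rw [insertStep_cons_of_some hz, insertStep_cons_of_some (z := φ z) (by simp [this, hz]), ih,
        this]
      simp

theorem insertWord_map (hφ : StrictMono φ) (w : List α) :
    insertWord (w.map φ) = (insertWord w).map (List.map φ) := by
  induction w using List.reverseRecOn with
  | nil => rfl
  | append_singleton w y ih =>
    rw [List.map_append, List.map_singleton, insertWord_concat, ih, insertStep_map hφ,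
      insertWord_concat]

theorem wordShape_map (hφ : StrictMono φ) (w : List α) : wordShape (w.map φ) = wordShape w := by
  funext i
  rw [wordShape, insertWord_map hφ, wordShape, rowLens, rowLens, ← List.map_nil (f := φ),
    List.getD_map, List.length_map]

theorem wordDiagram_map (hφ : StrictMono φ) {w : List α} (hw : w.Nodup) :
    wordDiagram (w.map φ) = wordDiagram w :=
  ext_of_mem_iff fun c => by
    rw [mem_wordDiagram (hw.map hφ.injective), mem_wordDiagram hw, wordShape_map hφ]

end StrictMonoMap

/-- The sequences whose first `n` terms are sorted by the permutation `σ`. -/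
def sortedBy {n : ℕ} (σ : Equiv.Perm (Fin n)) : Set (ℕ → unitInterval) :=
  {x | StrictMono fun k => x (σ k)}

theorem measurableSet_strictMono (n : ℕ) :
    MeasurableSet {f : Fin n → unitInterval | StrictMono f} := by
  have : {f : Fin n → unitInterval | StrictMono f} =
      ⋂ (i : Fin n) (j : Fin n) (_ : i < j), {f | f i < f j} := by
    ext f
    simp only [Set.mem_ofPred_eq, Set.mem_iInter]
    rfl
  rw [this]
  exact .iInter fun i => .iInter fun j => .iInter fun _ =>
    measurableSet_lt (measurable_pi_apply i) (measurable_pi_apply j)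

theorem measurableSet_sortedBy {n : ℕ} (σ : Equiv.Perm (Fin n)) : MeasurableSet (sortedBy σ) :=
  (measurableSet_strictMono n).preimage
    (measurable_pi_iff.2 fun k => measurable_pi_apply (σ k : ℕ))

instance : IsProbabilityMeasure lebProduct :=
  inferInstanceAs (IsProbabilityMeasure (Measure.infinitePi _))

theorem lebProduct_map_of_injective {ι : Type*} {f : ι → ℕ} (hf : Function.Injective f) :
    lebProduct.map (fun x i => x (f i)) =
      Measure.infinitePi fun _ : ι => (volume : Measure unitInterval) :=
  Measure.map_infinitePi_infinitePi_of_inj hf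

/-- Permuting i.i.d. coordinates preserves their law, so the value does not depend on `σ`. -/
theorem lebProduct_sortedBy {n : ℕ} (σ : Equiv.Perm (Fin n)) :
    lebProduct (sortedBy σ) =
      (Measure.infinitePi fun _ : Fin n => (volume : Measure unitInterval)) {f | StrictMono f} := by
  have hinj : Function.Injective fun k => (σ k : ℕ) := Fin.val_injective.comp σ.injective
  rw [← lebProduct_map_of_injective hinj, Measure.map_apply
    (measurable_pi_iff.2 fun k => measurable_pi_apply (σ k : ℕ)) (measurableSet_strictMono n)]
  rfl

/-- A finite set of values has only one increasing enumeration. -/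
theorem pairwise_disjoint_sortedBy (n : ℕ) :
    Pairwise (Function.onFun Disjoint (sortedBy (n := n))) := by
  intro σ τ hne
  refine Set.disjoint_left.2 fun x hσ hτ => hne ?_
  have h1 : ∀ ρ : Equiv.Perm (Fin n),
      Set.range (fun k => x (ρ k)) = Set.range fun k : Fin n => x k := fun ρ =>
    ρ.surjective.range_comp fun k : Fin n => x k
  have h2 := (StrictMono.range_inj hσ hτ).1 ((h1 σ).trans (h1 τ).symm)
  have h3 : Function.Injective fun k : Fin n => x k := by
    have := StrictMono.injective hσ
    exact (Equiv.injective_comp σ fun k : Fin n => x k).1 this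
  exact Equiv.ext fun k => h3 (congrFun h2 k)

/-- These are `n!` disjoint events of equal probability. Only an upper bound is needed, so ties play
no role. -/
theorem lebProduct_sortedBy_le {n : ℕ} (σ : Equiv.Perm (Fin n)) :
    lebProduct (sortedBy σ) ≤ ((n.factorial : ℕ) : ℝ≥0∞)⁻¹ := by
  have h1 : ∑ τ : Equiv.Perm (Fin n), lebProduct (sortedBy τ) ≤ 1 := by
    rw [← measure_univ (μ := lebProduct), ← tsum_fintype (L := SummationFilter.unconditional _),
      ← measure_iUnion (pairwise_disjoint_sortedBy n) measurableSet_sortedBy]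
    exact measure_mono (Set.subset_univ _)
  have h2 : ∀ τ : Equiv.Perm (Fin n), lebProduct (sortedBy τ) = lebProduct (sortedBy σ) :=
    fun τ => by rw [lebProduct_sortedBy, lebProduct_sortedBy]
  simp only [h2, Finset.sum_const, Finset.card_univ, Fintype.card_perm, Fintype.card_fin,
    nsmul_eq_mul] at h1
  rw [ENNReal.le_inv_iff_mul_le, mul_comm]
  exact h1

theorem initialWord_eq_ofFn {α : Type*} (x : ℕ → α) (n : ℕ) :
    initialWord x n = List.ofFn fun i : Fin n => x i :=
  List.ext_getElem (by simp [initialWord]) fun i h1 h2 => by simp [initialWord]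

theorem take_initialWord {α : Type*} (x : ℕ → α) {k n : ℕ} (h : k ≤ n) :
    (initialWord x n).take k = initialWord x k := by
  rw [initialWord, ← List.map_take, List.take_range, min_eq_left h, initialWord]

/-- The inverse appears because `σ` lists positions in increasing order of value, whereas the word
lists the rank of the value at each position. -/
theorem rskPath_of_mem_sortedBy {n : ℕ} {σ : Equiv.Perm (Fin n)} {x : ℕ → unitInterval}
    (hx : x ∈ sortedBy σ) {k : ℕ} (hk : k ≤ n) :
    rskPath x k = wordDiagram ((permWord σ.symm).take k) := by
  have h1 : initialWord x n = (List.ofFn σ.symm).map fun k => x (σ k) := by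
    rw [initialWord_eq_ofFn, List.map_ofFn]
    congr 1
    funext i
    simp
  have h2 : permWord σ.symm = (List.ofFn σ.symm).map fun i : Fin n => (i : ℕ) + 1 := by
    rw [permWord, List.map_ofFn]; rfl
  have hnd : ((List.ofFn σ.symm).take k).Nodup := (List.nodup_ofFn.2 σ.symm.injective).take
  have hmono : StrictMono fun i : Fin n => (i : ℕ) + 1 := fun i j h => Nat.succ_lt_succ h
  rw [rskPath, ← take_initialWord x hk, h1, h2, ← List.map_take, ← List.map_take,
    wordDiagram_map hx hnd, wordDiagram_map hmono hnd]

theorem exists_mem_sortedBy {n : ℕ} {x : ℕ → unitInterval} (hx : (initialWord x n).Nodup) :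
    ∃ σ : Equiv.Perm (Fin n), x ∈ sortedBy σ := by
  rw [initialWord_eq_ofFn, List.nodup_ofFn] at hx
  exact ⟨_, (Tuple.monotone_sort fun i : Fin n => x i).strictMono_of_injective
    (hx.comp (Equiv.injective _))⟩

theorem measurable_rskPath : Measurable (rskPath : (ℕ → unitInterval) → ℕ → YoungDiagram) := by
  refine measurable_pi_iff.2 fun n => measurable_to_countable' fun μ => ?_
  -- The shape is constant on each set `sortedBy σ`, and it is `⊥` by convention on the remaining
  -- sequences, which have a repetition.
  have : (fun x : ℕ → unitInterval => rskPath x n) ⁻¹' {μ} =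
      (⋃ (σ : Equiv.Perm (Fin n)) (_ : wordDiagram (permWord σ.symm) = μ), sortedBy σ) ∪
        ((⋃ σ : Equiv.Perm (Fin n), sortedBy σ)ᶜ ∩ {_x | ⊥ = μ}) := by
    ext x
    simp only [Set.mem_preimage, Set.mem_singleton_iff, Set.mem_union, Set.mem_iUnion,
      Set.mem_inter_iff, Set.mem_compl_iff, Set.mem_ofPred_eq, exists_prop]
    have hlen : ∀ σ : Equiv.Perm (Fin n), (permWord σ).take n = permWord σ := fun σ =>
      List.take_of_length_le (by simp [permWord])
    by_cases h : ∃ σ : Equiv.Perm (Fin n), x ∈ sortedBy σ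
    · obtain ⟨σ, hσ⟩ := h
      rw [rskPath_of_mem_sortedBy hσ le_rfl, hlen]
      constructor
      · exact fun h => Or.inl ⟨σ, h, hσ⟩
      · rintro (⟨τ, h, hτ⟩ | ⟨h, -⟩)
        · rw [← hlen, ← rskPath_of_mem_sortedBy hσ le_rfl, rskPath_of_mem_sortedBy hτ le_rfl, hlen,
            h]
        · exact absurd ⟨σ, hσ⟩ h
    · have hbot : rskPath x n = ⊥ := by
        rw [rskPath, wordDiagram, dif_neg fun hnd => h (exists_mem_sortedBy hnd)]
      rw [hbot]
      constructor
      · exact fun h' => Or.inr ⟨h, h'⟩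
      · rintro (⟨τ, -, hτ⟩ | ⟨-, h'⟩)
        · exact absurd ⟨τ, hτ⟩ h
        · exact h'
  rw [this]
  exact (MeasurableSet.iUnion fun σ => .iUnion fun _ => measurableSet_sortedBy σ).union
    ((MeasurableSet.iUnion fun σ => measurableSet_sortedBy σ).compl.inter (.const _))

theorem ae_injective : ∀ᵐ x ∂lebProduct, Function.Injective x := by
  have h : ∀ i j : ℕ, i ≠ j → ∀ᵐ x ∂lebProduct, x i ≠ x j := by
    intro i j hij
    have hmap : lebProduct.map (fun x => (x i, x j)) =
        (volume : Measure unitInterval).prod volume := Measure.infinitePi_map_eval_prod hij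
    have hd : MeasurableSet {p : unitInterval × unitInterval | p.1 = p.2} :=
      measurableSet_eq_fun measurable_fst measurable_snd
    have h0 : ((volume : Measure unitInterval).prod volume)
        {p : unitInterval × unitInterval | p.1 = p.2} = 0 := by
      rw [Measure.measure_prod_null hd]
      refine Filter.Eventually.of_forall fun a => ?_
      have : Prod.mk a ⁻¹' {p : unitInterval × unitInterval | p.1 = p.2} = {a} := by
        ext b; simp [eq_comm]
      simp only [this, Pi.zero_apply]
      exact measure_singleton a
    rw [← hmap, Measure.map_apply (by fun_prop) hd] at h0
    exact measure_eq_zero_iff_ae_notMem.1 h0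
  have h' : ∀ᵐ x ∂lebProduct, ∀ i j : ℕ, i ≠ j → x i ≠ x j :=
    ae_all_iff.2 fun i => ae_all_iff.2 fun j => by
      by_cases hij : i = j
      · simp [hij]
      · simpa [hij] using h i j hij
  filter_upwards [h'] with x hx i j hij
  by_contra hne
  exact hx i j hne hij

/-- Up to a null set the event is a union of ordering events: at most `numSYT (p n)` of them, each
of probability at most `1 / n!`. -/
theorem lebProduct_rskPath_le (n : ℕ) (p : ℕ → YoungDiagram) :
    lebProduct {x | ∀ k ≤ n, rskPath x k = p k} ≤
      (numSYT (p n) : ℝ≥0∞) * ((n.factorial : ℕ) : ℝ≥0∞)⁻¹ := by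
  classical
  set S := Finset.univ.filter fun σ : Equiv.Perm (Fin n) =>
      ∀ k ≤ n, wordDiagram ((permWord σ).take k) = p k with hS
  have hsub : {x : ℕ → unitInterval | ∀ k ≤ n, rskPath x k = p k} ≤ᵐ[lebProduct]
      ⋃ σ ∈ S, sortedBy σ.symm := by
    filter_upwards [ae_injective] with x hx hp
    obtain ⟨σ, hσ⟩ := exists_mem_sortedBy (nodup_initialWord hx n)
    refine Set.mem_iUnion₂.2 ⟨σ.symm, ?_, by simpa using hσ⟩
    rw [hS, Finset.mem_filter]
    exact ⟨Finset.mem_univ _, fun k hk => by rw [← rskPath_of_mem_sortedBy hσ hk]; exact hp k hk⟩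
  calc lebProduct {x | ∀ k ≤ n, rskPath x k = p k}
      ≤ lebProduct (⋃ σ ∈ S, sortedBy σ.symm) := measure_mono_ae hsub
    _ ≤ ∑ σ ∈ S, lebProduct (sortedBy σ.symm) := measure_biUnion_finset_le _ _
    _ ≤ ∑ σ ∈ S, ((n.factorial : ℕ) : ℝ≥0∞)⁻¹ :=
        Finset.sum_le_sum fun σ _ => lebProduct_sortedBy_le σ.symm
    _ = (S.card : ℝ≥0∞) * ((n.factorial : ℕ) : ℝ≥0∞)⁻¹ := by rw [Finset.sum_const, nsmul_eq_mul]
    _ ≤ _ := by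
        gcongr
        exact card_perm_le_numSYT n p

/-! ### The Plancherel growth process as the law of the RSK shapes -/

instance : IsProbabilityMeasure plancherelGrowth :=
  inferInstanceAs (IsProbabilityMeasure (Kernel.trajMeasure (X := fun _ => YoungDiagram) _ _))

theorem measurableSet_path_eq (n : ℕ) (p : ℕ → YoungDiagram) :
    MeasurableSet {h : ℕ → YoungDiagram | ∀ k ≤ n, h k = p k} := by
  have : {h : ℕ → YoungDiagram | ∀ k ≤ n, h k = p k} = ⋂ (k : ℕ) (_ : k ≤ n), {h | h k = p k} := by
    ext h
    simp
  rw [this]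
  exact .iInter fun k => .iInter fun _ => measurableSet_eq_fun (measurable_pi_apply k) measurable_const

theorem preimage_frestrictLe (n : ℕ) (p : ℕ → YoungDiagram) :
    Preorder.frestrictLe (π := fun _ : ℕ => YoungDiagram) n ⁻¹' {Preorder.frestrictLe n p} =
      {h : ℕ → YoungDiagram | ∀ k ≤ n, h k = p k} := by
  ext h
  simp only [Set.mem_preimage, Set.mem_singleton_iff, Set.mem_ofPred_eq, funext_iff, Subtype.forall,
    Finset.mem_Iic]
  rfl

theorem plancherelGrowth_zero : plancherelGrowth {h | h 0 = ⊥} = 1 := by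
  have h1 : plancherelGrowth.map (Preorder.frestrictLe 0) =
      (Measure.dirac (⊥ : YoungDiagram)).map
        (MeasurableEquiv.piUnique (fun _ : Finset.Iic 0 => YoungDiagram)).symm := by
    rw [plancherelGrowth, Kernel.trajMeasure, Measure.map_comp _ _ (by fun_prop),
      Kernel.traj_map_frestrictLe, Kernel.partialTraj_self, Measure.id_comp]
  have h2 : {h : ℕ → YoungDiagram | h 0 = ⊥} = Preorder.frestrictLe
      (π := fun _ : ℕ => YoungDiagram) 0 ⁻¹' {f | f ⟨0, by simp⟩ = ⊥} := rfl
  have hm : MeasurableSet {f : (i : Finset.Iic 0) → YoungDiagram | f ⟨0, by simp⟩ = ⊥} :=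
    measurable_pi_apply _ (measurableSet_singleton _)
  rw [h2, ← Measure.map_apply (by fun_prop) hm, h1, Measure.map_apply (by fun_prop) hm,
    Measure.dirac_apply' _ (hm.preimage (by fun_prop))]
  exact Set.indicator_of_mem (show _ = _ from rfl) _

theorem plancherelGrowth_succ (n : ℕ) (p : ℕ → YoungDiagram) :
    plancherelGrowth {h | ∀ k ≤ n + 1, h k = p k} =
      plancherelGrowth {h | ∀ k ≤ n, h k = p k} * transitionProb (p n) (p (n + 1)) := by
  have h1 : {h : ℕ → YoungDiagram | ∀ k ≤ n + 1, h k = p k} =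
      (fun h : ℕ → YoungDiagram => (Preorder.frestrictLe (π := fun _ : ℕ => YoungDiagram) n h,
        h (n + 1))) ⁻¹' ({Preorder.frestrictLe n p} ×ˢ {p (n + 1)}) := by
    rw [Set.mk_preimage_prod, preimage_frestrictLe]
    ext h
    simp only [Set.mem_ofPred_eq, Set.mem_inter_iff, Set.mem_preimage, Set.mem_singleton_iff]
    constructor
    · exact fun hh => ⟨fun k hk => hh k (by omega), hh _ le_rfl⟩
    · rintro ⟨h1, h2⟩ k hk
      rcases Nat.le_succ_iff.1 hk with hk | rfl
      · exact h1 k hk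
      · exact h2
  have hms : MeasurableSet ({Preorder.frestrictLe n p} :
      Set ((i : Finset.Iic n) → (fun _ : ℕ => YoungDiagram) i)) := measurableSet_singleton _
  rw [h1, ← Measure.map_apply (by fun_prop) (hms.prod (measurableSet_singleton _)),
    plancherelGrowth, ← Kernel.map_frestrictLe_trajMeasure_compProd_eq_map_trajMeasure,
    Measure.compProd_apply_prod hms (measurableSet_singleton _), lintegral_singleton,
    Measure.map_apply (by fun_prop) hms, preimage_frestrictLe, mul_comm]
  congr 1
  exact PMF.toMeasure_apply_singleton _ _ (measurableSet_singleton _)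

/-- The probability of an initial segment of the Plancherel growth process. -/
theorem plancherelGrowth_path (n : ℕ) {p : ℕ → YoungDiagram} (h0 : p 0 = ⊥)
    (hp : ∀ k < n, Adds (p k) (p (k + 1))) :
    plancherelGrowth {h | ∀ k ≤ n, h k = p k} =
      (numSYT (p n) : ℝ≥0∞) * ((n.factorial : ℕ) : ℝ≥0∞)⁻¹ := by
  have hcard : ∀ k ≤ n, (p k).card = k := by
    intro k
    induction k with
    | zero => intro _; rw [h0]; rfl
    | succ k ih => intro hk; rw [(hp k hk).2, ih (by omega)]
  induction n with
  | zero =>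
    have : {h : ℕ → YoungDiagram | ∀ k ≤ 0, h k = p k} = {h | h 0 = ⊥} := by
      ext h
      simp [h0]
    rw [this, plancherelGrowth_zero, h0, numSYT_bot]
    simp
  | succ n ih =>
    -- The product telescopes: `numSYT (p n)` cancels against the denominator of the transition
    -- probability, whose factor `n + 1` completes the factorial.
    rw [plancherelGrowth_succ, ih (fun k hk => hp k (by omega)) (fun k hk => hcard k (by omega)),
      transitionProb, if_pos (hp n (by omega)), hcard n (by omega), Nat.factorial_succ,
      Nat.cast_mul, div_eq_mul_inv]
    have hf : (numSYT (p n) : ℝ≥0∞) ≠ 0 := by exact_mod_cast (numSYT_pos (p n)).ne'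
    have hf' : (numSYT (p n) : ℝ≥0∞) ≠ ∞ := ENNReal.natCast_ne_top _
    rw [ENNReal.mul_inv (Or.inr hf') (Or.inr hf),
      ENNReal.mul_inv (Or.inr (ENNReal.natCast_ne_top _)) (Or.inl (ENNReal.natCast_ne_top _))]
    calc _ = ((numSYT (p n) : ℝ≥0∞) * (numSYT (p n) : ℝ≥0∞)⁻¹) * ((numSYT (p (n + 1)) : ℝ≥0∞) *
          ((((n + 1 : ℕ) : ℝ≥0∞))⁻¹ * ((n.factorial : ℕ) : ℝ≥0∞)⁻¹)) := by ring
      _ = _ := by rw [ENNReal.mul_inv_cancel hf hf', one_mul]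

/-- Since both total masses are one, no point can have strictly smaller mass. This turns the
one-sided counting bound into an identity of laws. -/
theorem eq_of_singleton_le {β : Type*} [MeasurableSpace β] [Countable β]
    [MeasurableSingletonClass β] {μ ν : Measure β} [IsProbabilityMeasure μ]
    [IsProbabilityMeasure ν] (h : ∀ a, μ {a} ≤ ν {a}) : μ = ν := by
  refine Measure.eq_of_le_of_isProbabilityMeasure (Measure.le_iff.2 fun s _ => ?_)
  rw [← Set.biUnion_of_singleton s, measure_biUnion s.to_countable
    (fun a _ b _ hab => by simpa using hab) (fun a _ => measurableSet_singleton a),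
    measure_biUnion s.to_countable
    (fun a _ b _ hab => by simpa using hab) (fun a _ => measurableSet_singleton a)]
  exact ENNReal.tsum_le_tsum fun a => h a

theorem map_frestrictLe_rskPath (n : ℕ) :
    (lebProduct.map rskPath).map (Preorder.frestrictLe n) =
      plancherelGrowth.map (Preorder.frestrictLe (π := fun _ : ℕ => YoungDiagram) n) := by
  have i1 : IsProbabilityMeasure (lebProduct.map (rskPath (α := unitInterval))) :=
    Measure.isProbabilityMeasure_map measurable_rskPath.aemeasurable
  have i2 : IsProbabilityMeasure ((lebProduct.map rskPath).map
      (Preorder.frestrictLe (π := fun _ : ℕ => YoungDiagram) n)) :=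
    Measure.isProbabilityMeasure_map (by fun_prop)
  have i3 : IsProbabilityMeasure (plancherelGrowth.map
      (Preorder.frestrictLe (π := fun _ : ℕ => YoungDiagram) n)) :=
    Measure.isProbabilityMeasure_map (by fun_prop)
  refine eq_of_singleton_le fun a => ?_
  obtain ⟨p, rfl⟩ : ∃ p : ℕ → YoungDiagram, Preorder.frestrictLe n p = a :=
    ⟨fun k => if h : k ≤ n then a ⟨k, Finset.mem_Iic.2 h⟩ else ⊥, funext fun k => by
      have := Finset.mem_Iic.1 k.2
      simp [Preorder.frestrictLe, this]⟩
  rw [Measure.map_apply (by fun_prop) (measurableSet_singleton _),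
    Measure.map_apply (by fun_prop) (measurableSet_singleton _), preimage_frestrictLe,
    Measure.map_apply measurable_rskPath (measurableSet_path_eq n p)]
  -- On genuine paths the counting bound equals the Plancherel mass. All other initial segments are
  -- null for the RSK shapes.
  by_cases hp : p 0 = ⊥ ∧ ∀ k < n, Adds (p k) (p (k + 1))
  · rw [plancherelGrowth_path n hp.1 hp.2]
    exact lebProduct_rskPath_le n p
  · refine (measure_mono_null_ae (t := ∅) ?_ measure_empty).trans_le zero_le
    filter_upwards [ae_injective] with x hx hpx
    refine hp ⟨?_, fun k hk => ?_⟩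
    · rw [← hpx 0 (Nat.zero_le _), rskPath_zero]
    · rw [← hpx k hk.le, ← hpx (k + 1) hk]
      exact adds_rskPath hx k

/-- The RSK shapes of an i.i.d. sequence form the Plancherel growth process. -/
theorem map_rskPath : lebProduct.map rskPath = plancherelGrowth := by
  have i1 : IsProbabilityMeasure (lebProduct.map (rskPath (α := unitInterval))) :=
    Measure.isProbabilityMeasure_map measurable_rskPath.aemeasurable
  have hP : IsProjectiveMeasureFamily (α := fun _ : ℕ => YoungDiagram)
      fun I : Finset ℕ => plancherelGrowth.map I.restrict := by
    intro I J hJI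
    rw [Measure.map_map (by fun_prop) (by fun_prop)]
    rfl
  -- A law on sequences is determined by its finite marginals, and initial segments suffice.
  refine IsProjectiveLimit.unique (P := fun I : Finset ℕ => plancherelGrowth.map I.restrict)
    ((isProjectiveLimit_nat_iff hP _).2 map_frestrictLe_rskPath) fun I => rfl

/-! ### Ergodicity of the shift -/

theorem measurable_shift : Measurable (shift : (ℕ → unitInterval) → ℕ → unitInterval) :=
  measurable_pi_iff.2 fun n => measurable_pi_apply (n + 1)

theorem measurePreserving_shift : MeasurePreserving shift lebProduct lebProduct :=
  ⟨measurable_shift, lebProduct_map_of_injective Nat.succ_injective⟩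

theorem shift_iterate {α : Type*} (n : ℕ) (x : ℕ → α) : shift^[n] x = fun k => x (k + n) := by
  induction n generalizing x with
  | zero => rfl
  | succ n ih =>
    rw [Function.iterate_succ_apply, ih]
    funext k
    simp only [shift]
    congr 1

/-- An invariant set equals its preimage under the `n`-th iterate, hence depends only on the
coordinates from `n` on, for every `n`. It is thus a tail event, and Kolmogorov's zero-one law
applies. -/
theorem ergodic_shift : Ergodic shift lebProduct := by
  refine ⟨measurePreserving_shift, ⟨fun s hs hinv => ?_⟩⟩
  let m : ℕ → MeasurableSpace (ℕ → unitInterval) := fun n =>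
    MeasurableSpace.comap (fun x => x n) inferInstance
  have hle : ∀ n, m n ≤ MeasurableSpace.pi := fun n => (measurable_pi_apply n).comap_le
  have hind : iIndep m lebProduct :=
    iIndepFun_infinitePi (P := fun _ : ℕ => (volume : Measure unitInterval))
      (X := fun _ => id) fun _ => measurable_id
  have htail : MeasurableSet[Filter.limsup m Filter.atTop] s := by
    rw [Filter.limsup_eq_iInf_iSup_of_nat, MeasurableSpace.measurableSet_iInf]
    intro n
    have hpre : shift^[n] ⁻¹' s = s := by
      rw [Set.preimage_iterate_eq]
      exact (Function.IsFixedPt.iterate hinv n :)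
    rw [← hpre]
    refine @MeasurableSet.preimage _ _ (_) _ _ _ hs ?_
    refine @measurable_pi_lambda _ _ _ (_) _ _ fun k => ?_
    simp only [shift_iterate]
    have h1 : m (k + n) ≤ ⨆ i, ⨆ (_ : i ≥ n), m i := le_iSup₂_of_le (k + n) (by omega) le_rfl
    exact (comap_measurable _).mono h1 le_rfl
  rw [Filter.eventuallyConst_set]
  rcases measure_zero_or_one_of_measurableSet_limsup_atTop hle hind htail with h | h
  · exact Or.inr (measure_eq_zero_iff_ae_notMem.1 h)
  · exact Or.inl ((prob_compl_eq_zero_iff hs).2 h)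

/-! ### Infinite tableaux as paths -/

namespace InfiniteTableau

theorem measurable_entry (c : ℕ × ℕ) : Measurable fun t : InfiniteTableau => t.entry c :=
  Measurable.of_comap_le (le_iSup (fun c : ℕ × ℕ =>
    MeasurableSpace.comap (fun t : InfiniteTableau => t.entry c) ⊤) c)

theorem measurable_of_entry_le {β : Type*} [MeasurableSpace β] {f : β → InfiniteTableau}
    (h : ∀ c n, MeasurableSet {b | (f b).entry c ≤ n}) : Measurable f := by
  rw [measurable_iff_comap_le]
  change MeasurableSpace.comap f (⨆ c : ℕ × ℕ, MeasurableSpace.comap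
    (fun t : InfiniteTableau => t.entry c) ⊤) ≤ _
  rw [MeasurableSpace.comap_iSup]
  refine iSup_le fun c => ?_
  rw [MeasurableSpace.comap_comp]
  have : Measurable fun b => (f b).entry c := measurable_of_Iic fun n => h c n
  exact this.comap_le

theorem shapePath_zero (t : InfiniteTableau) : t.shapePath 0 = ⊥ :=
  ext_of_mem_iff fun c => by
    have := t.one_le c
    simp only [shapePath, mem_shape, YoungDiagram.notMem_bot, iff_false]
    omega

theorem adds_shapePath (t : InfiniteTableau) (n : ℕ) :
    Adds (t.shapePath n) (t.shapePath (n + 1)) := by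
  obtain ⟨m, -, hm⟩ := t.bijOn.surjOn (Set.mem_Ici.2 (Nat.le_add_left 1 n))
  refine adds_of_mem_iff (m := m) ?_ fun c => ?_
  · simp only [shapePath, mem_shape]
    omega
  · simp only [shapePath, mem_shape, Nat.le_succ_iff, Nat.succ_eq_add_one]
    rw [or_comm, ← hm, t.injective.eq_iff]

theorem mem_range_shapePath {p : ℕ → YoungDiagram} :
    p ∈ Set.range shapePath ↔
      p 0 = ⊥ ∧ (∀ n, Adds (p n) (p (n + 1))) ∧ ∀ c, ∃ n, c ∈ p n := by
  constructor
  · rintro ⟨t, rfl⟩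
    exact ⟨t.shapePath_zero, t.adds_shapePath, fun c => ⟨_, t.mem_shape.2 le_rfl⟩⟩
  · rintro ⟨h0, h1, h2⟩
    obtain ⟨t, ht⟩ := exists_infiniteTableau h0 h1 h2
    exact ⟨t, funext fun n => ext_of_mem_iff fun c => t.mem_shape.trans (ht n c)⟩

theorem shapePath_injective : Function.Injective shapePath := fun t t' h =>
  ext_of_le_iff fun n c => by
    rw [← mem_shape, ← mem_shape]
    exact iff_of_eq (congrArg (c ∈ ·) (congrFun h n))

theorem measurableSet_mem (n : ℕ) (c : ℕ × ℕ) :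
    MeasurableSet {p : ℕ → YoungDiagram | c ∈ p n} :=
  (measurable_pi_apply n : Measurable fun p : ℕ → YoungDiagram => p n)
    (MeasurableSet.of_discrete (s := {μ : YoungDiagram | c ∈ μ}))

theorem measurableSet_range_shapePath : MeasurableSet (Set.range shapePath) := by
  have : Set.range shapePath = {p : ℕ → YoungDiagram | p 0 = ⊥} ∩
      ((⋂ n, {p | Adds (p n) (p (n + 1))}) ∩ ⋂ c, ⋃ n, {p | c ∈ p n}) := by
    ext p
    simp only [mem_range_shapePath, Set.mem_inter_iff, Set.mem_ofPred_eq, Set.mem_iInter,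
      Set.mem_iUnion]
  rw [this]
  refine (measurableSet_eq_fun (measurable_pi_apply 0) measurable_const).inter
    ((MeasurableSet.iInter fun n => ?_).inter
      (.iInter fun c => .iUnion fun n => measurableSet_mem n c))
  exact ((measurable_pi_apply n).prodMk (measurable_pi_apply (n + 1)) :
    Measurable fun p : ℕ → YoungDiagram => (p n, p (n + 1)))
    (MeasurableSet.of_discrete (s := {q : YoungDiagram × YoungDiagram | Adds q.1 q.2}))

/-- The infinite tableau with a given path (and a fixed one if there is none). -/
noncomputable def ofPath : (ℕ → YoungDiagram) → InfiniteTableau := Function.invFun shapePath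

theorem ofPath_shapePath (t : InfiniteTableau) : ofPath t.shapePath = t :=
  Function.leftInverse_invFun shapePath_injective t

theorem measurable_ofPath : Measurable ofPath := by
  refine measurable_of_entry_le fun c n => ?_
  have : {p : ℕ → YoungDiagram | (ofPath p).entry c ≤ n} =
      (Set.range shapePath ∩ {p | c ∈ p n}) ∪
        ((Set.range shapePath)ᶜ ∩ {_p | (Classical.arbitrary InfiniteTableau).entry c ≤ n}) := by
    ext p
    by_cases hp : p ∈ Set.range shapePath
    · obtain ⟨t, rfl⟩ := hp
      simp only [Set.mem_ofPred_eq, ofPath_shapePath, Set.mem_union, Set.mem_inter_iff,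
        Set.mem_range_self, Set.mem_compl_iff, not_true_eq_false, false_and, or_false, true_and,
        shapePath, mem_shape]
    · have : ofPath p = Classical.arbitrary _ := Function.invFun_neg hp
      simp [this, hp]
  rw [this]
  exact (measurableSet_range_shapePath.inter (measurableSet_mem n c)).union
    (measurableSet_range_shapePath.compl.inter (.const _))

theorem measurable_shapePath : Measurable shapePath := by
  refine measurable_pi_iff.2 fun n => measurable_to_countable' fun μ => ?_
  have : (fun t : InfiniteTableau => t.shapePath n) ⁻¹' {μ} =
      ⋂ c : ℕ × ℕ, {t | t.entry c ≤ n ↔ c ∈ μ} := by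
    ext t
    simp only [Set.mem_preimage, Set.mem_singleton_iff, Set.mem_iInter, Set.mem_ofPred_eq,
      ← mem_shape]
    exact ⟨fun h c => h ▸ Iff.rfl, ext_of_mem_iff⟩
  rw [this]
  exact .iInter fun c => measurable_entry c
    (MeasurableSet.of_discrete (s := {k : ℕ | k ≤ n ↔ c ∈ μ}))

/-- This gives the `Measure.comap` in `plancherelMeasure` its intended meaning: the measure of a set
of tableaux is that of its image among paths. -/
theorem measurableEmbedding_shapePath : MeasurableEmbedding shapePath :=
  .of_measurable_inverse measurable_shapePath measurableSet_range_shapePath measurable_ofPath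
    ofPath_shapePath

/-! ### Measurability of jeu de taquin -/

theorem measurable_jdtPath (k : ℕ) : Measurable fun t : InfiniteTableau => t.jdtPath k := by
  induction k with
  | zero => exact measurable_const
  | succ k ih =>
    refine measurable_to_countable' fun c => ?_
    have : (fun t : InfiniteTableau => t.jdtPath (k + 1)) ⁻¹' {c} =
        ⋃ d : ℕ × ℕ, (fun t : InfiniteTableau => t.jdtPath k) ⁻¹' {d} ∩
          {t | (if t.entry (d.1 + 1, d.2) < t.entry (d.1, d.2 + 1) then (d.1 + 1, d.2)
            else (d.1, d.2 + 1)) = c} := by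
      ext t
      simp [jdtPath]
    rw [this]
    refine .iUnion fun d => (ih (measurableSet_singleton d)).inter ?_
    exact measurableSet_eq_fun (Measurable.ite
      (measurableSet_lt (measurable_entry _) (measurable_entry _)) measurable_const
      measurable_const) measurable_const

/-- The path meets each antidiagonal once, so a box can only be visited at the index given by the
sum of its coordinates. Replacing the existential by this single test makes measurability evident.
-/
theorem jdtEntry_eq (t : InfiniteTableau) (c : ℕ × ℕ) :
    t.jdtEntry c = if t.jdtPath (c.1 + c.2) = c then
      min (t.entry (c.1 + 1, c.2)) (t.entry (c.1, c.2 + 1)) - 1 else t.entry c - 1 := by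
  split_ifs with h
  · conv_lhs => rw [← h, t.jdtEntry_path, jdtPath, h]
    split_ifs with h'
    · rw [min_eq_left h'.le]
    · rw [min_eq_right (not_lt.1 h')]
  · refine t.jdtEntry_off fun k hk => h ?_
    rw [← hk, t.jdtPath_sum]

theorem measurable_jdt : Measurable jdt := by
  refine measurable_of_entry_le fun c n => ?_
  have : Measurable fun t : InfiniteTableau => t.jdtEntry c := by
    simp only [jdtEntry_eq]
    exact Measurable.ite (measurable_jdtPath _ (measurableSet_singleton c))
      (((measurable_entry _).min (measurable_entry _)).sub_const 1)
      ((measurable_entry c).sub_const 1)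
  exact this measurableSet_Iic

end InfiniteTableau

/-! ### The factor map -/

/-- Removing the first term only shrinks the shapes, so the event contains its shift preimage almost
surely, and ergodicity leaves probability zero or one. No asymptotics of the shapes are needed. -/
theorem ae_exists_mem_rskPath (c : ℕ × ℕ) : ∀ᵐ x ∂lebProduct, ∃ n, c ∈ rskPath x n := by
  have hB : MeasurableSet {p : ℕ → YoungDiagram | ∃ n, c ∈ p n} := by
    simp only [Set.ofPred_exists]
    exact .iUnion fun n => InfiniteTableau.measurableSet_mem n c
  have hA := hB.preimage measurable_rskPath
  have hsub : shift ⁻¹' (rskPath ⁻¹' {p : ℕ → YoungDiagram | ∃ n, c ∈ p n}) ≤ᵐ[lebProduct]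
      (rskPath ⁻¹' {p : ℕ → YoungDiagram | ∃ n, c ∈ p n}) := by
    filter_upwards [ae_injective] with x hx
    rintro ⟨n, hn⟩
    exact ⟨n + 1, (mem_rskPath hx).2
      (rskShape_shift_subset hx n ((mem_rskPath (shift_injective hx)).1 hn))⟩
  rcases ergodic_shift.ae_empty_or_univ_of_preimage_ae_le hA.nullMeasurableSet hsub with h | h
  · exfalso
    have h0 := measure_congr h
    rw [measure_empty, ← Measure.map_apply measurable_rskPath hB, map_rskPath] at h0
    -- Any tableau would do: its path up to time `t.entry c` already contains `c` and has positive
    -- probability, which rules out zero.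
    let t : InfiniteTableau := default
    have hsub' : {p : ℕ → YoungDiagram | ∀ k ≤ t.entry c, p k = t.shapePath k} ⊆
        {p | ∃ n, c ∈ p n} := fun p hp =>
      ⟨t.entry c, by rw [hp _ le_rfl]; exact t.mem_shape.2 le_rfl⟩
    have h1 := measure_mono_null hsub' h0
    rw [plancherelGrowth_path _ t.shapePath_zero fun k _ => t.adds_shapePath k] at h1
    have h2 := (numSYT_pos (t.shapePath (t.entry c))).ne'
    simp [h2] at h1
  · exact Filter.eventuallyEq_univ.1 h

theorem ae_mem_rskDomain : ∀ᵐ x ∂lebProduct, x ∈ rskDomain := by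
  filter_upwards [ae_injective, ae_all_iff.2 ae_exists_mem_rskPath] with x hx h
  exact mem_rskDomain_iff.2 ⟨hx, fun c => (h c).imp fun n hn => (mem_rskPath hx).1 hn⟩

theorem rskPath_mem_range_iff {x : ℕ → unitInterval} :
    rskPath x ∈ Set.range InfiniteTableau.shapePath ↔ x ∈ rskDomain := by
  refine ⟨fun h => ?_, fun h => ⟨_, shapePath_rsk h⟩⟩
  obtain ⟨h0, h1, h2⟩ := InfiniteTableau.mem_range_shapePath.1 h
  have hx : Function.Injective x := by
    have hnd : ∀ n, (initialWord x (n + 1)).Nodup := by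
      intro n
      by_contra hn
      -- A repetition makes the diagram at time `n + 1` empty, while a growing path has at least one
      -- box there.
      have hc := (h1 n).2
      rw [rskPath, wordDiagram, dif_neg hn] at hc
      simp [YoungDiagram.card] at hc
    intro i j hij
    have := hnd (max i j)
    rw [initialWord_eq_ofFn, List.nodup_ofFn] at this
    have hi : i < max i j + 1 := by omega
    have hj : j < max i j + 1 := by omega
    simpa using this (a₁ := ⟨i, hi⟩) (a₂ := ⟨j, hj⟩) hij
  exact mem_rskDomain_iff.2 ⟨hx, fun c => (h2 c).imp fun n hn => (mem_rskPath hx).1 hn⟩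

theorem rsk_eq_ofPath {x : ℕ → unitInterval} (hx : x ∈ rskDomain) :
    rsk x = InfiniteTableau.ofPath (rskPath x) := by
  rw [← shapePath_rsk hx, InfiniteTableau.ofPath_shapePath]

theorem measurableSet_rskDomain : MeasurableSet (rskDomain : Set (ℕ → unitInterval)) := by
  have : (rskDomain : Set (ℕ → unitInterval)) =
      rskPath ⁻¹' Set.range InfiniteTableau.shapePath := by
    ext x
    exact rskPath_mem_range_iff.symm
  rw [this]
  exact InfiniteTableau.measurableSet_range_shapePath.preimage measurable_rskPath

theorem measurable_rsk : Measurable (rsk : (ℕ → unitInterval) → InfiniteTableau) := by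
  classical
  have : (rsk : (ℕ → unitInterval) → InfiniteTableau) = fun x =>
      if x ∈ rskDomain then InfiniteTableau.ofPath (rskPath x) else default := by
    funext x
    split_ifs with h
    · exact rsk_eq_ofPath h
    · exact dif_neg h
  rw [this]
  exact Measurable.ite measurableSet_rskDomain
    (InfiniteTableau.measurable_ofPath.comp measurable_rskPath) measurable_const

/-- This is `map_rskPath` read through the embedding `shapePath`, which sends `rsk x` to `rskPath x`
for almost every `x`. -/
theorem measurePreserving_rsk : MeasurePreserving rsk lebProduct plancherelMeasure := by
  refine ⟨measurable_rsk, Measure.ext fun s hs => ?_⟩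
  rw [plancherelMeasure, InfiniteTableau.measurableEmbedding_shapePath.comap_apply, ← map_rskPath,
    Measure.map_apply measurable_rskPath
      (InfiniteTableau.measurableEmbedding_shapePath.measurableSet_image.2 hs),
    Measure.map_apply measurable_rsk hs]
  refine measure_congr ?_
  filter_upwards [ae_mem_rskDomain] with x hx
  refine propext ?_
  change rsk x ∈ s ↔ rskPath x ∈ InfiniteTableau.shapePath '' s
  rw [← shapePath_rsk hx, InfiniteTableau.shapePath_injective.mem_set_image]

/-- Restricting to paths of tableaux loses no mass, because almost every sequence lies in
`rskDomain`. -/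
instance : IsProbabilityMeasure plancherelMeasure := by
  rw [← measurePreserving_rsk.map_eq]
  exact Measure.isProbabilityMeasure_map measurable_rsk.aemeasurable

theorem measurePreserving_jdt :
    MeasurePreserving InfiniteTableau.jdt plancherelMeasure plancherelMeasure := by
  refine ⟨InfiniteTableau.measurable_jdt, ?_⟩
  conv_lhs => rw [← measurePreserving_rsk.map_eq]
  rw [Measure.map_map InfiniteTableau.measurable_jdt measurable_rsk,
    ← (measurePreserving_rsk.comp measurePreserving_shift).map_eq]
  refine Measure.map_congr ?_
  filter_upwards [ae_mem_rskDomain] with x hx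
  exact (jdt_rsk hx).2

/-- Ergodicity passes to factors: the `rsk` preimage of a `jdt`-invariant set is invariant under
`shift` up to a null set. -/
theorem ergodic_jdt : Ergodic InfiniteTableau.jdt plancherelMeasure := by
  refine ⟨measurePreserving_jdt, ⟨fun s hs hinv => ?_⟩⟩
  have hinv' : shift ⁻¹' (rsk ⁻¹' s) =ᵐ[lebProduct] rsk ⁻¹' s := by
    filter_upwards [ae_mem_rskDomain] with x hx
    refine propext ?_
    change rsk (shift x) ∈ s ↔ rsk x ∈ s
    rw [← (jdt_rsk hx).2]
    exact iff_of_eq (congrArg (rsk x ∈ ·) hinv)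
  rw [Filter.eventuallyConst_set, ← measurePreserving_rsk.map_eq]
  refine (ergodic_shift.quasiErgodic.ae_mem_or_ae_notMem₀
    (hs.preimage measurable_rsk).nullMeasurableSet hinv').imp (fun h => ?_) fun h => ?_
  · exact (ae_map_iff measurable_rsk.aemeasurable hs).2 h
  · exact (ae_map_iff measurable_rsk.aemeasurable hs.compl).2 h

end JeuDeTaquin

theorem mainTheorem4 :
    -- `P` is a probability measure, and `J` preserves it and is ergodic
    IsProbabilityMeasure JeuDeTaquin.plancherelMeasure ∧
    MeasurePreserving JeuDeTaquin.InfiniteTableau.jdt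
      JeuDeTaquin.plancherelMeasure JeuDeTaquin.plancherelMeasure ∧
    Ergodic JeuDeTaquin.InfiniteTableau.jdt JeuDeTaquin.plancherelMeasure ∧
    -- the system is a factor, via RSK, of the shift on i.i.d. uniform sequences
    (∀ᵐ x ∂JeuDeTaquin.lebProduct, x ∈ JeuDeTaquin.rskDomain) ∧
    MeasurePreserving JeuDeTaquin.rsk JeuDeTaquin.lebProduct JeuDeTaquin.plancherelMeasure ∧
    (∀ x : ℕ → unitInterval, x ∈ JeuDeTaquin.rskDomain →
      JeuDeTaquin.shift x ∈ JeuDeTaquin.rskDomain ∧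
      (JeuDeTaquin.rsk x).jdt = JeuDeTaquin.rsk (JeuDeTaquin.shift x)) := by
  exact ⟨inferInstance, JeuDeTaquin.measurePreserving_jdt, JeuDeTaquin.ergodic_jdt,
    JeuDeTaquin.ae_mem_rskDomain, JeuDeTaquin.measurePreserving_rsk,
    fun _ hx => JeuDeTaquin.jdt_rsk hx⟩
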